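/- **Setting.** Let $d\ge 2$ and let $\mathcal P_x$ be a probability distribution on $\mathbb R^d$ with mean zero and $\|x\|_2\le r$ almost surely for some $r\ge 1$. Let $\Sigma=\mathbb E\{xx^{\mathsf T}\}$ have eigenvalues $\lambda_1>\lambda_2\ge\dots\ge\lambda_d\ge 0$, let $q^*$ be a unit eigenvector for $\lambda_1$, and let $\sigma^2=\mathbb E\{\|xx^{\mathsf T}-\Sigma\|_F^2\}$. Let $x_1,x_2,\dots$ be i.i.d. with law $\mathcal P_x$, and let $v_0$ be uniformly distributed on the unit sphere and independent of them. For $N,b\ge 1$ put $B=bN$ and $x_{i,j,t}=x_{j+(i-1)b+(t-1)B}$. The distributed mini-batch Krasulina method (DMK), without data loss, with step sizes $\gamma_t$ is $$v_t=v_{t-1}+\frac{\gamma_t}{B}\sum_{i=1}^N\sum_{j=1}^b\Big(x_{i,j,t}x_{i,j,t}^{\mathsf T}v_{t-1}-\frac{v_{t-1}^{\mathsf T}x_{i,j,t}x_{i,j,t}^{\mathsf T}v_{t-1}}{\|v_{t-1}\|_2^2}\,v_{t-1}\Big),\qquad t\ge1 .$$ Let $\Psi_t=1-(v_t^{\mathsf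 T}q^*)^2/\|v_t\|_2^2$ and $\sigma_B^2=\mathbb E\big\{\big\|\frac1B\sum_{i,j}x_{i,j,t}x_{i,j,t}^{\mathsf T}-\Sigma\big\|_F^2\big\}$. For pairs $(t_0,\epsilon_0),\dots,(t_J,\epsilon_J)$ with $0=t_0<t_1<\dots<t_J$ and $0<\epsilon_0<\epsilon_1<\dots<\epsilon_J$, define the nested sample spaces $$\Omega_t'=\Big\{\omega:\ \forall\, 0\le j\le J,\ \sup_{t_j\le l<t}\Psi_l(\omega)\le 1-\epsilon_j\Big\},\qquad t\ge1,$$ and let $\mathbb E_t\{\cdot\}$ be the expectation conditional on the event $\Omega_t'$. **Parameters.** Fix $\delta\in(0,1)$ and $c_0>2$, and put $c=\dfrac{c_0}{2(\lambda_1-\lambda_2)}$, $$L_1=\frac{64\,e\,d\,r^4\max(1,c^2)}{\delta^2}\ln\frac4\delta,\qquad L_2=\frac{512\,e^2d^2\sigma_B^2\max(1,c^2)}{\delta^4}\ln\frac4\delta .$$ Pick $L_1'\ge L_1$ and $L_2'\ge L_2/\sigma_B^2$ (read as $L_2'\ge0$ if $\sigma_B^2=0$), and put $L=L_1'+\sigma_B^2L_2'$,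 $\gamma_t=c/(L+t)$, $$C_1=\frac12\Big(\frac{4ed}{\delta^2}\Big)^{\frac{5}{2\ln2}}e^{2c^2\lambda_1^2/L},\qquad C_2=\frac{8c^2e^{(c_0+2c^2\lambda_1^2)/L}}{c_0-2}.$$ **Claim.** There is a sequence of pairs as above whose nested sample spaces satisfy $\mathbb P\big(\bigcap_{t>0}\Omega_t'\big)\ge1-\delta$ and such that, for every total number of samples $T$ that is a multiple of $B$ and satisfies $B\le T^{1-2/c_0}$, the error after $T_B:=T/B$ iterations satisfies $$\mathbb E_{T_B}\{\Psi_{T_B}\}\ \le\ c_0C_1\frac{L_1'^{\,c_0/2}}{T}+c_0C_1\Big(\frac{\sigma^2L_2'}{T}\Big)^{c_0/2}+\frac{C_2\sigma^2}{T}.$$ In particular, the error is $O(1/T)$: the right-hand side is at most $K/T$ with a constant $K$ that does not depend on $N$, $b$ and $T$. -/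

import Mathlib

open MeasureTheory ProbabilityTheory

noncomputable section

namespace DMK

/-- The ambient space `ℝ^d` with the Euclidean norm. -/
abbrev Vec (d : ℕ) : Type := EuclideanSpace ℝ (Fin d)

/-- The rank-one matrix `x xᵀ`. -/
def outer {d : ℕ} (x : Vec d) : Matrix (Fin d) (Fin d) ℝ :=
  Matrix.of fun i j => x i * x j

/-- The covariance matrix `Σ = E[x xᵀ]` of a (zero-mean) distribution `μ` on `ℝ^d`. -/
def covMatrix {d : ℕ} (μ : Measure (Vec d)) : Matrix (Fin d) (Fin d) ℝ :=
  Matrix.of fun i j => ∫ x, outer x i j ∂μ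

lemma covMatrix_isHermitian {d : ℕ} (μ : Measure (Vec d)) : (covMatrix μ).IsHermitian := by
  ext i j
  simp [covMatrix, outer, Matrix.conjTranspose_apply, mul_comm]

/-- The eigenvalues of the covariance matrix in decreasing order, with multiplicity:
`eigval μ 0` is the largest one, `eigval μ 1` the second largest one, and so on. -/
def eigval {d : ℕ} (μ : Measure (Vec d)) (k : Fin d) : ℝ :=
  (covMatrix_isHermitian μ).eigenvalues₀ (Fin.cast (Fintype.card_fin d).symm k)

/-- The squared Frobenius norm of a matrix. -/
def frobSq {d : ℕ} (M : Matrix (Fin d) (Fin d) ℝ) : ℝ := ∑ i, ∑ j, M i j ^ 2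

/-- The variance `σ² = E ‖x xᵀ - Σ‖_F²` of the sample covariance matrix. -/
def sigmaSq {d : ℕ} (μ : Measure (Vec d)) : ℝ :=
  ∫ x, frobSq (outer x - covMatrix μ) ∂μ

/-- The variance `σ_B² = E ‖(1/B) ∑_{i ≤ N} ∑_{j ≤ b} x_{i,j} x_{i,j}ᵀ - Σ‖_F²`, `B = b N`, of the
sample covariance matrix of a network-wide mini-batch, the `x_{i,j}` being i.i.d. with law `μ`. -/
def sigmaBSq {d : ℕ} (μ : Measure (Vec d)) (N b : ℕ) : ℝ :=
  ∫ x : Fin N × Fin b → Vec d,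
    frobSq (((N * b : ℕ) : ℝ)⁻¹ • (∑ i : Fin N, ∑ j : Fin b, outer (x (i, j))) - covMatrix μ)
    ∂(Measure.pi fun _ => μ)

/-- The uniform probability distribution on the unit sphere of `ℝ^d`, as a measure on `ℝ^d`. -/
def uniformSphere (d : ℕ) : Measure (Vec d) :=
  (((volume : Measure (Vec d)).toSphere Set.univ)⁻¹ • (volume : Measure (Vec d)).toSphere).map
    Subtype.val

/-- The contribution `x xᵀ v - (vᵀ x xᵀ v) v / ‖v‖²` of one sample `x` to the update of `v`. -/
def localUpdate {d : ℕ} (x v : Vec d) : Vec d :=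
  (inner ℝ x v) • x - ((inner ℝ x v) ^ 2 / ‖v‖ ^ 2) • v

/-- The iterates `v_0, v_1, …` of the distributed mini-batch Krasulina method with `N` processors,
local mini-batches of size `b` and step sizes `γ_1, γ_2, …`, run on the data stream `x`. The stream
is numbered from `0`, so that `x k` is the sample arriving at time `k + 1`. In iteration `t + 1`,
the `j`-th sample of processor `i` (both numbered from `0`) is the one numbered
`j + i b + t B`, where `B = b N`. -/
def iterate {d : ℕ} (N b : ℕ) (γ : ℕ → ℝ) (v₀ : Vec d) (x : ℕ → Vec d) : ℕ → Vec d
  | 0 => v₀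
  | t + 1 =>
    iterate N b γ v₀ x t + γ (t + 1) • (((N * b : ℕ) : ℝ)⁻¹ •
      ∑ i : Fin N, ∑ j : Fin b,
        localUpdate (x ((j : ℕ) + (i : ℕ) * b + t * (N * b))) (iterate N b γ v₀ x t))

/-- The potential function `1 - (vᵀ q)² / ‖v‖²`. -/
def potential {d : ℕ} (q v : Vec d) : ℝ := 1 - (inner ℝ v q) ^ 2 / ‖v‖ ^ 2

/-- A finite sequence of pairs `(t_0, ε_0), …, (t_J, ε_J)` with `0 = t_0 < t_1 < … < t_J` and
`0 < ε_0 < ε_1 < … < ε_J`. -/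
structure Schedule where
  /-- the index of the last pair -/
  J : ℕ
  /-- the times -/
  time : Fin (J + 1) → ℕ
  /-- the levels -/
  level : Fin (J + 1) → ℝ
  time_zero : time 0 = 0
  time_strictMono : StrictMono time
  level_pos : 0 < level 0
  level_strictMono : StrictMono level

/-- The nested sample spaces `Ω'_t = {ω | ∀ j ≤ J, sup_{t_j ≤ l < t} Ψ_l(ω) ≤ 1 - ε_j}` of a
sequence of random variables `Ψ_0, Ψ_1, …`. -/
def nestedSpace {Ω : Type*} (S : Schedule) (Ψ : ℕ → Ω → ℝ) (t : ℕ) : Set Ω :=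
  {ω | ∀ j : Fin (S.J + 1), ∀ l : ℕ, S.time j ≤ l → l < t → Ψ l ω ≤ 1 - S.level j}

/-- `c = c_0 / (2 (λ_1 - λ_2))`. -/
def stepConst (c₀ lam₁ lam₂ : ℝ) : ℝ := c₀ / (2 * (lam₁ - lam₂))

/-- `L_1 = (64 e d r⁴ max(1, c²) / δ²) ln(4/δ)`. -/
def L1 (d : ℕ) (r c δ : ℝ) : ℝ :=
  64 * Real.exp 1 * d * r ^ 4 * max 1 (c ^ 2) / δ ^ 2 * Real.log (4 / δ)

/-- `L_2 = (512 e² d² σ_B² max(1, c²) / δ⁴) ln(4/δ)`, where `sB` is `σ_B²`. -/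
def L2 (d : ℕ) (sB c δ : ℝ) : ℝ :=
  512 * Real.exp 1 ^ 2 * d ^ 2 * sB * max 1 (c ^ 2) / δ ^ 4 * Real.log (4 / δ)

/-- `C_1 = (1/2) (4 e d / δ²)^{5 / (2 ln 2)} e^{2 c² λ_1² / L}`. -/
def C1 (d : ℕ) (δ c lam₁ L : ℝ) : ℝ :=
  1 / 2 * (4 * Real.exp 1 * d / δ ^ 2) ^ (5 / (2 * Real.log 2)) *
    Real.exp (2 * c ^ 2 * lam₁ ^ 2 / L)

/-- `C_2 = 8 c² e^{(c_0 + 2 c² λ_1²) / L} / (c_0 - 2)`. -/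
def C2 (c₀ c lam₁ L : ℝ) : ℝ :=
  8 * c ^ 2 * Real.exp ((c₀ + 2 * c ^ 2 * lam₁ ^ 2) / L) / (c₀ - 2)

/-- The error bound
`c_0 C_1 L_1'^{c_0/2} / T + c_0 C_1 (σ² L_2' / T)^{c_0/2} + C_2 σ² / T`, where `s` is `σ²`. -/
def errorBound (c₀ C₁ C₂ L₁' L₂' s T : ℝ) : ℝ :=
  c₀ * C₁ * (L₁' ^ (c₀ / 2) / T) + c₀ * C₁ * (s * L₂' / T) ^ (c₀ / 2) + C₂ * s / T

end DMK

end

/-! The Lyapunov function is the odds `Ψ / (1 - Ψ) = 1 / (1 - Ψ) - 1`. Let `a` be the cosine between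
the current direction and `q`, so that `1 - Ψ = a ^ 2`. A step is tangential: it adds `γ` times a
linear term to `a` and enlarges the squared norm only at order `γ ^ 2`. Expanding `1 / (1 - Ψ)` to
second order, the mean of the linear term produces the drift `-2 γ (λ₁ - λ₂)` times the odds. As
long as `Ψ ≤ 1 - ε`, the quadratic terms cost at most `16 γ ^ 2 (λ₁ ^ 2 + σ_B ^ 2 / ε)` times the
odds, plus `4 γ ^ 2 σ_B ^ 2`. The additive term contains only the noise variance because the mean
update vanishes at `q`. With `γ = c / n`, `n = L + t + 1`, this is the recursion with factor `1 - c₀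
/ n + κ / n ^ 2` and inhomogeneity `4 c ^ 2 σ_B ^ 2 / n ^ 2` (`SpectralGap.lintegral_odds_step_le`,
and `SpectralGap.setLIntegral_odds_le` along the stream).

The recursion is used twice. First, `1 + odds = 1 / (1 - Ψ)` is a supermartingale up to factors `1 +
κ / n ^ 2`, whose product is at most `exp (κ / L) ≤ 2`. A maximal inequality
(`measure_sdiff_stayBelow_le`) bounds by `2 ε / s` the probability of starting with `Ψ₀ ≤ 1 - s` and
ever exceeding `1 - ε`. A uniform starting direction has `Ψ₀ > 1 - s` with probability at most `√(s
d)` (`uniformSphere_potential_gt_le`). The choices `s = δ ^ 2 / (4 d)` and `ε = δ ^ 3 / (16 d)` make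
both bounds `δ / 2`. One pair `(0, ε)` therefore suffices as a schedule.

Second, restricting to the event that the odds are below a threshold cannot raise their conditional
mean (`setLIntegral_inter_le`), so the recursion survives conditioning on the nested spaces. It is
solved by `decay / ε + H / (L + t)`: the start is forgotten at rate `t ^ (-c₀)` and the noise leaves
a term of order `1 / t`. Since `Ψ ≤ odds`, this bounds the conditional error. Finally `σ_B ^ 2 = σ ^
2 / B` and `B ≤ T ^ (1 - 2 / c₀)` turn it into the bound in `T`; the constant `C1` amply covers the
factor `2 / ε`. -/

namespace DMK

/-! ### The covariance matrix as a bounded symmetric quadratic form -/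

section Covariance

variable {d : ℕ}

/-- The covariance matrix acting on vectors. -/
noncomputable def covLin (μ : Measure (Vec d)) : Vec d →ₗ[ℝ] Vec d :=
  Matrix.toEuclideanLin (covMatrix μ)

lemma inner_toEuclideanLin (A : Matrix (Fin d) (Fin d) ℝ) (u h : Vec d) :
    inner ℝ (Matrix.toEuclideanLin A u) h = ∑ i, ∑ j, A i j * (u j * h i) := by
  simp only [PiLp.inner_apply, Matrix.toLpLin_apply, Matrix.mulVec, dotProduct]
  refine Finset.sum_congr rfl fun i _ => ?_
  simp [Finset.mul_sum]
  refine Finset.sum_congr rfl fun j _ => ?_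
  ring

lemma abs_apply_le_norm (x : Vec d) (i : Fin d) : |x i| ≤ ‖x‖ := by
  simpa using PiLp.norm_apply_le x i

lemma measurable_outer (i j : Fin d) : Measurable fun x : Vec d => outer x i j := by
  simp only [outer, Matrix.of_apply]
  fun_prop

lemma abs_outer_le {r : ℝ} {x : Vec d} (hx : ‖x‖ ≤ r) (i j : Fin d) :
    |outer x i j| ≤ r ^ 2 := by
  have h1 := abs_apply_le_norm x i
  have h2 := abs_apply_le_norm x j
  simp only [outer, Matrix.of_apply, abs_mul]
  nlinarith [abs_nonneg (x i), abs_nonneg (x j), norm_nonneg x]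

variable {μ : Measure (Vec d)} [IsProbabilityMeasure μ] {r : ℝ}

lemma integrable_outer (hb : ∀ᵐ x ∂μ, ‖x‖ ≤ r) (i j : Fin d) :
    Integrable (fun x => outer x i j) μ := by
  refine Integrable.of_bound (measurable_outer i j).aestronglyMeasurable (r ^ 2) ?_
  filter_upwards [hb] with x hx
  exact abs_outer_le hx i j

lemma inner_mul_inner_eq_sum (x u h : Vec d) :
    inner ℝ x u * inner ℝ x h = ∑ i, ∑ j, outer x i j * (u j * h i) := by
  simp only [PiLp.inner_apply, outer, Matrix.of_apply]
  rw [mul_comm, Finset.sum_mul_sum]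
  refine Finset.sum_congr rfl fun i _ => Finset.sum_congr rfl fun j _ => ?_
  simp
  ring

lemma integral_inner_mul_inner (hb : ∀ᵐ x ∂μ, ‖x‖ ≤ r) (u h : Vec d) :
    ∫ x, inner ℝ x u * inner ℝ x h ∂μ = inner ℝ (covLin μ u) h := by
  rw [covLin, inner_toEuclideanLin]
  simp only [inner_mul_inner_eq_sum]
  rw [integral_finsetSum]
  · refine Finset.sum_congr rfl fun i _ => ?_
    rw [integral_finsetSum]
    · refine Finset.sum_congr rfl fun j _ => ?_
      rw [integral_mul_const]
      rfl
    · intro j _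
      exact (integrable_outer hb i j).mul_const _
  · intro i _
    exact integrable_finsetSum _ fun j _ => (integrable_outer hb i j).mul_const _

lemma inner_covLin_self_nonneg (hb : ∀ᵐ x ∂μ, ‖x‖ ≤ r) (u : Vec d) :
    0 ≤ inner ℝ (covLin μ u) u := by
  rw [← integral_inner_mul_inner hb]
  exact integral_nonneg fun x => mul_self_nonneg _

lemma inner_covLin_self_le (hb : ∀ᵐ x ∂μ, ‖x‖ ≤ r) (u : Vec d) :
    inner ℝ (covLin μ u) u ≤ r ^ 2 * ‖u‖ ^ 2 := by
  rw [← integral_inner_mul_inner hb]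
  have : ∀ᵐ x ∂μ, ‖inner ℝ x u * inner ℝ x u‖ ≤ r ^ 2 * ‖u‖ ^ 2 := by
    filter_upwards [hb] with x hx
    have h1 := abs_real_inner_le_norm x u
    have h2 : |inner ℝ x u| ≤ r * ‖u‖ :=
      h1.trans (mul_le_mul_of_nonneg_right hx (norm_nonneg u))
    rw [Real.norm_eq_abs, abs_mul]
    nlinarith [abs_nonneg (inner ℝ x u)]
  have h3 := norm_integral_le_of_norm_le_const this
  simp only [probReal_univ, mul_one] at h3
  exact (le_abs_self _).trans h3

lemma covLin_symm (μ : Measure (Vec d)) (u w : Vec d) :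
    inner ℝ (covLin μ u) w = inner ℝ u (covLin μ w) :=
  (Matrix.isSymmetric_toEuclideanLin_iff.mpr (covMatrix_isHermitian μ)) u w

end Covariance

/-! ### Consequences of the spectral gap -/

section Spectral

variable {d : ℕ} {μ : Measure (Vec d)} [IsProbabilityMeasure μ] {r lam₁ lam₂ : ℝ} {q : Vec d}

/-- The data of a covariance matrix with a spectral gap. -/
structure SpectralGap (μ : Measure (Vec d)) (lam₁ lam₂ : ℝ) (q : Vec d) : Prop where
  norm_q : ‖q‖ = 1
  map_q : covLin μ q = lam₁ • q
  lam₂_nonneg : 0 ≤ lam₂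
  lt : lam₂ < lam₁
  inner_le : ∀ w, inner ℝ w q = 0 → inner ℝ (covLin μ w) w ≤ lam₂ * ‖w‖ ^ 2
  norm_sub_le : ∀ w, inner ℝ w q = 0 → ‖covLin μ w - lam₁ • w‖ ≤ lam₁ * ‖w‖

/-- The gap makes the top eigenvalue simple, so `q` is a multiple of the first basis eigenvector,
and vectors orthogonal to `q` have only coefficients with eigenvalues in `[0, λ₂]`. Both
inequalities are then compared coefficient by coefficient. -/
lemma spectralGap (h0 : 0 < d) (h1 : 1 < d) (hb : ∀ᵐ x ∂μ, ‖x‖ ≤ r)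
    (hlam₁ : lam₁ = eigval μ ⟨0, h0⟩) (hlam₂ : lam₂ = eigval μ ⟨1, h1⟩)
    (hgap : lam₂ < lam₁) (hq : ‖q‖ = 1)
    (hqeig : (covMatrix μ).mulVec q.ofLp = lam₁ • q.ofLp) :
    SpectralGap μ lam₁ lam₂ q := by
  classical
  set hA := covMatrix_isHermitian μ
  set e := Fintype.equivOfCardEq (Fintype.card_fin (Fintype.card (Fin d))) with he
  have hev : ∀ i, hA.eigenvalues i = hA.eigenvalues₀ (e.symm i) := fun i => rfl
  set bas := hA.eigenvectorBasis
  have hmap : ∀ i, covLin μ (bas i) = hA.eigenvalues i • bas i := by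
    intro i
    rw [covLin, Matrix.toLpLin_apply, hA.mulVec_eigenvectorBasis]
    rfl
  have hmq : covLin μ q = lam₁ • q := by
    rw [covLin, Matrix.toLpLin_apply, hqeig]
    rfl
  have hcard : Fintype.card (Fin d) = d := Fintype.card_fin d
  set k0 : Fin (Fintype.card (Fin d)) := Fin.cast hcard.symm ⟨0, h0⟩
  set k1 : Fin (Fintype.card (Fin d)) := Fin.cast hcard.symm ⟨1, h1⟩
  have hl1 : lam₁ = hA.eigenvalues (e k0) := by rw [hev, hlam₁]; simp [eigval, k0]
  have hl2 : lam₂ = hA.eigenvalues (e k1) := by rw [hev, hlam₂]; simp [eigval, k1]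
  have hnonneg : ∀ i, 0 ≤ hA.eigenvalues i := by
    intro i
    have := inner_covLin_self_nonneg hb (bas i)
    rw [hmap, real_inner_smul_left, real_inner_self_eq_norm_sq] at this
    simpa using this
  have hle : ∀ i, i ≠ e k0 → hA.eigenvalues i ≤ lam₂ := by
    intro i hi
    rw [hl2, hev, hev]
    apply hA.eigenvalues₀_antitone
    have h1 : e.symm i ≠ k0 := fun h => hi (by rw [← h]; simp)
    have h2 : (e.symm i).val ≠ 0 := fun h => h1 (Fin.ext h)
    rw [Equiv.symm_apply_apply, Fin.le_def]
    change 1 ≤ (e.symm i).val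
    omega
  have hle1 : ∀ i, hA.eigenvalues i ≤ lam₁ := by
    intro i
    by_cases h : i = e k0
    · rw [h, hl1]
    · exact (hle i h).trans hgap.le
  -- Eigenvectors of a symmetric map for different eigenvalues are orthogonal.
  have hqi : ∀ i, i ≠ e k0 → inner ℝ (bas i) q = 0 := by
    intro i hi
    have h1 := covLin_symm μ (bas i) q
    rw [hmap, hmq, real_inner_smul_left, real_inner_smul_right] at h1
    have h2 := hle i hi
    have h3 : (hA.eigenvalues i - lam₁) * inner ℝ (bas i) q = 0 := by linarith
    rcases mul_eq_zero.1 h3 with h | h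
    · linarith
    · exact h
  have hq0 : inner ℝ (bas (e k0)) q ≠ 0 := by
    intro h
    have h1 := bas.sum_sq_norm_inner_right q
    rw [Finset.sum_eq_zero, hq] at h1
    · norm_num at h1
    · intro i _
      by_cases hi : i = e k0
      · rw [hi, h]; simp
      · rw [hqi i hi]; simp
  have hw0 : ∀ w, inner ℝ w q = 0 → inner ℝ (bas (e k0)) w = 0 := by
    intro w hw
    have h1 := bas.sum_inner_mul_inner w q
    rw [hw, Finset.sum_eq_single (e k0)] at h1
    · rcases mul_eq_zero.1 h1 with h | h
      · rwa [real_inner_comm]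
      · exact absurd h hq0
    · intro i _ hi
      rw [hqi i hi, mul_zero]
    · simp
  have hcoef : ∀ i w, inner ℝ (bas i) (covLin μ w) = hA.eigenvalues i * inner ℝ (bas i) w := by
    intro i w
    rw [← covLin_symm, hmap, real_inner_smul_left]
  refine ⟨hq, hmq, ?_, hgap, ?_, ?_⟩
  · rw [hl2]; exact hnonneg _
  · intro w hw
    rw [← bas.sum_inner_mul_inner, ← bas.sum_sq_norm_inner_right w, Finset.mul_sum]
    refine Finset.sum_le_sum fun i _ => ?_
    rw [real_inner_comm, hcoef, Real.norm_eq_abs, sq_abs]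
    by_cases hi : i = e k0
    · rw [hi, hw0 w hw]; simp
    · nlinarith [hle i hi, sq_nonneg (inner ℝ (bas i) w)]
  · intro w hw
    have hl1p : 0 ≤ lam₁ := by rw [hl1]; exact hnonneg _
    refine (sq_le_sq₀ (norm_nonneg _) (by positivity)).1 ?_
    rw [mul_pow, ← bas.sum_sq_norm_inner_right w, ← bas.sum_sq_norm_inner_right (_ - _),
      Finset.mul_sum]
    refine Finset.sum_le_sum fun i _ => ?_
    rw [inner_sub_right, hcoef, real_inner_smul_right, Real.norm_eq_abs, sq_abs,
      Real.norm_eq_abs, sq_abs, ← sub_mul, mul_pow]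
    refine mul_le_mul_of_nonneg_right ?_ (sq_nonneg _)
    nlinarith [hle1 i, hnonneg i]

lemma SpectralGap.lam₁_pos {μ : Measure (Vec d)} (h : SpectralGap μ lam₁ lam₂ q) : 0 < lam₁ :=
  h.lam₂_nonneg.trans_lt h.lt

lemma SpectralGap.lam₁_le (h : SpectralGap μ lam₁ lam₂ q) (hb : ∀ᵐ x ∂μ, ‖x‖ ≤ r) :
    lam₁ ≤ r ^ 2 := by
  have := inner_covLin_self_le hb q
  rw [h.map_q, real_inner_smul_left, real_inner_self_eq_norm_sq, h.norm_q] at this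
  linarith

end Spectral

/-! ### Algebra of a single update -/

section Step

variable {d N b : ℕ}

/-- The sample covariance matrix of a mini-batch. -/
noncomputable def sampleCov (z : Fin N × Fin b → Vec d) : Matrix (Fin d) (Fin d) ℝ :=
  ((N * b : ℕ) : ℝ)⁻¹ • ∑ i : Fin N, ∑ j : Fin b, outer (z (i, j))

/-- The sample covariance matrix of a mini-batch acting on vectors. -/
noncomputable def sampleLin (z : Fin N × Fin b → Vec d) (v : Vec d) : Vec d :=
  ((N * b : ℕ) : ℝ)⁻¹ • ∑ i : Fin N, ∑ j : Fin b, (inner ℝ (z (i, j)) v) • z (i, j)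

/-- One iteration of the method on the mini-batch `z`. -/
noncomputable def step (γ : ℝ) (z : Fin N × Fin b → Vec d) (v : Vec d) : Vec d :=
  v + γ • (((N * b : ℕ) : ℝ)⁻¹ • ∑ i : Fin N, ∑ j : Fin b, localUpdate (z (i, j)) v)

/-- The component of `e` orthogonal to a unit vector `u`. -/
noncomputable def perp (u e : Vec d) : Vec d := e - (inner ℝ u e) • u

lemma toEuclideanLin_outer (x v : Vec d) :
    Matrix.toEuclideanLin (outer x) v = (inner ℝ x v) • x := by
  ext i
  simp only [Matrix.toLpLin_apply, Matrix.mulVec, dotProduct, outer, Matrix.of_apply,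
    PiLp.smul_apply, PiLp.inner_apply, smul_eq_mul, Finset.sum_mul]
  refine Finset.sum_congr rfl fun j _ => ?_
  simp
  ring

lemma toEuclideanLin_sampleCov (z : Fin N × Fin b → Vec d) (v : Vec d) :
    Matrix.toEuclideanLin (sampleCov z) v = sampleLin z v := by
  simp only [sampleCov, sampleLin, map_smul, map_sum, LinearMap.smul_apply,
    LinearMap.sum_apply, toEuclideanLin_outer]

/-- The subtracted term of the Krasulina update is the radial part of the sample covariance applied
to `u`, so the increment is orthogonal to `u`. -/
lemma step_unit (γ : ℝ) (z : Fin N × Fin b → Vec d) {u : Vec d} (hu : ‖u‖ = 1) :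
    step γ z u = u + γ • perp u (sampleLin z u) := by
  have h : ∀ x : Vec d, localUpdate x u = (inner ℝ x u) • x - (inner ℝ x u) ^ 2 • u := by
    intro x
    simp [localUpdate, hu]
  simp only [step, h, perp, sampleLin, Finset.sum_sub_distrib, smul_sub, ← Finset.sum_smul,
    inner_smul_right, inner_sum, smul_smul]
  have h2 : ∀ i j, inner ℝ (z (i, j)) u * inner ℝ u (z (i, j)) = inner ℝ (z (i, j)) u ^ 2 := by
    intro i j
    rw [real_inner_comm u, sq]
  simp only [h2]

/-- Homogeneity reduces all estimates to unit vectors, although the iterates are never normalized.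
-/
lemma step_smul (γ : ℝ) (z : Fin N × Fin b → Vec d) {k : ℝ} (hk : k ≠ 0) (u : Vec d) :
    step γ z (k • u) = k • step γ z u := by
  have h : ∀ x : Vec d, localUpdate x (k • u) = k • localUpdate x u := by
    intro x
    simp only [localUpdate, real_inner_smul_right, norm_smul, mul_pow, smul_sub, smul_smul,
      Real.norm_eq_abs, sq_abs]
    congr 2
    field_simp
  simp only [step, h, ← Finset.smul_sum, smul_add, smul_smul]
  congr 2
  ring

lemma potential_smul (q : Vec d) {k : ℝ} (hk : k ≠ 0) (u : Vec d) :
    potential q (k • u) = potential q u := by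
  simp only [potential, real_inner_smul_left, norm_smul, mul_pow, Real.norm_eq_abs, sq_abs]
  congr 1
  field_simp

lemma norm_perp_sq {u : Vec d} (hu : ‖u‖ = 1) (e : Vec d) :
    ‖perp u e‖ ^ 2 = ‖e‖ ^ 2 - (inner ℝ u e) ^ 2 := by
  rw [perp, norm_sub_sq_real, norm_smul, hu, real_inner_smul_right, real_inner_comm]
  simp only [Real.norm_eq_abs, mul_one, sq_abs]
  rw [real_inner_comm]
  ring

lemma norm_perp_le {u : Vec d} (hu : ‖u‖ = 1) (e : Vec d) : ‖perp u e‖ ≤ ‖e‖ := by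
  refine (sq_le_sq₀ (norm_nonneg _) (norm_nonneg _)).1 ?_
  rw [norm_perp_sq hu]
  nlinarith [sq_nonneg (inner ℝ u e)]

lemma inner_perp_left {u : Vec d} (hu : ‖u‖ = 1) (e : Vec d) : inner ℝ u (perp u e) = 0 := by
  rw [perp, inner_sub_right, real_inner_smul_right, real_inner_self_eq_norm_sq, hu]
  ring

lemma inner_perp_comm (u e q : Vec d) :
    inner ℝ (perp u e) q = inner ℝ e (perp u q) := by
  simp only [perp, inner_sub_left, inner_sub_right, real_inner_smul_left, real_inner_smul_right]
  rw [real_inner_comm u e]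
  ring

lemma norm_sampleLin_le {z : Fin N × Fin b → Vec d} {r : ℝ} (hz : ∀ p, ‖z p‖ ≤ r)
    (v : Vec d) : ‖sampleLin z v‖ ≤ r ^ 2 * ‖v‖ := by
  rcases Nat.eq_zero_or_pos (N * b) with h0 | h0
  · simp only [sampleLin, h0]
    simp
    positivity
  have hB : (0 : ℝ) < ((N * b : ℕ) : ℝ) := by exact_mod_cast h0
  rw [sampleLin, norm_smul, norm_inv, Real.norm_of_nonneg hB.le, inv_mul_le_iff₀ hB]
  have h1 : ∀ p, ‖(inner ℝ (z p) v) • z p‖ ≤ r ^ 2 * ‖v‖ := by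
    intro p
    have h2 := abs_real_inner_le_norm (z p) v
    have h3 := mul_le_mul_of_nonneg_right (hz p) (norm_nonneg v)
    rw [norm_smul, Real.norm_eq_abs]
    calc _ ≤ (r * ‖v‖) * r :=
          mul_le_mul (h2.trans h3) (hz p) (norm_nonneg _) ((abs_nonneg _).trans (h2.trans h3))
      _ = _ := by ring
  calc _ ≤ ∑ i : Fin N, ∑ j : Fin b, r ^ 2 * ‖v‖ :=
        (norm_sum_le _ _).trans (Finset.sum_le_sum fun i _ =>
          (norm_sum_le _ _).trans (Finset.sum_le_sum fun j _ => h1 _))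
    _ = _ := by
      simp only [Finset.sum_const, Finset.card_univ, Fintype.card_fin, nsmul_eq_mul]
      push_cast
      ring

/-- Cauchy–Schwarz in each row. This is how the Frobenius deviation controls the noise in the update
direction. -/
lemma norm_toEuclideanLin_sq_le (A : Matrix (Fin d) (Fin d) ℝ) (u : Vec d) :
    ‖Matrix.toEuclideanLin A u‖ ^ 2 ≤ frobSq A * ‖u‖ ^ 2 := by
  rw [EuclideanSpace.norm_sq_eq, EuclideanSpace.norm_sq_eq, frobSq, Finset.sum_mul]
  refine Finset.sum_le_sum fun i _ => ?_
  simp only [Real.norm_eq_abs, sq_abs, Matrix.toLpLin_apply, Matrix.mulVec, dotProduct]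
  exact Finset.sum_mul_sq_le_sq_mul_sq _ _ _

lemma frobSq_nonneg (A : Matrix (Fin d) (Fin d) ℝ) : 0 ≤ frobSq A :=
  Finset.sum_nonneg fun _ _ => Finset.sum_nonneg fun _ _ => sq_nonneg _

/-- The Taylor polynomial with its linear term kept exact, since the mean of that term is the
contraction; the coefficient `6` instead of `3` absorbs the remainder. -/
lemma inv_one_add_sq_le {ρ : ℝ} (h : |ρ| ≤ 1 / 4) :
    1 / (1 + ρ) ^ 2 ≤ 1 - 2 * ρ + 6 * ρ ^ 2 := by
  obtain ⟨h1, h2⟩ := abs_le.1 h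
  rw [div_le_iff₀ (by nlinarith)]
  nlinarith [mul_nonneg (sq_nonneg ρ) (by linarith : (0 : ℝ) ≤ ρ + 1 / 4),
    mul_nonneg (mul_nonneg (sq_nonneg ρ) (by linarith : (0 : ℝ) ≤ ρ + 1 / 4)) (by linarith : (0 : ℝ) ≤ 1 / 4 - ρ), sq_nonneg ρ, sq_nonneg (ρ^2)]

lemma inv_one_add_sq_le_two {ρ : ℝ} (h : |ρ| ≤ 1 / 4) : 1 / (1 + ρ) ^ 2 ≤ 2 := by
  obtain ⟨h1, h2⟩ := abs_le.1 h
  rw [div_le_iff₀ (by nlinarith)]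
  nlinarith

/-- `1 - Ψ` after one step, from a unit vector. -/
lemma one_sub_potential_step (γ : ℝ) (z : Fin N × Fin b → Vec d) {u q : Vec d} (hu : ‖u‖ = 1) :
    1 - potential q (step γ z u) =
      (inner ℝ u q + γ * inner ℝ (sampleLin z u) (perp u q)) ^ 2 /
        (1 + γ ^ 2 * ‖perp u (sampleLin z u)‖ ^ 2) := by
  have h1 : ‖step γ z u‖ ^ 2 = 1 + γ ^ 2 * ‖perp u (sampleLin z u)‖ ^ 2 := by
    rw [step_unit _ _ hu, norm_add_sq_real, hu, real_inner_smul_right, inner_perp_left hu,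
      norm_smul, mul_pow, Real.norm_eq_abs, sq_abs]
    ring
  rw [potential, h1, step_unit _ _ hu, inner_add_left, real_inner_smul_left, inner_perp_comm]
  ring

end Step

/-! ### Pathwise expansion of `1 / (1 - Ψ)` over one step -/

section OneStep

variable {d N b : ℕ} {μ : Measure (Vec d)} {r lam₁ lam₂ : ℝ} {q : Vec d}

lemma inner_perp_right {u : Vec d} (hq : ‖q‖ = 1) : inner ℝ (perp q u) q = 0 := by
  rw [real_inner_comm]; exact inner_perp_left hq u

lemma SpectralGap.covLin_eq (h : SpectralGap μ lam₁ lam₂ q) (u : Vec d) :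
    covLin μ u = lam₁ • u + (covLin μ (perp q u) - lam₁ • perp q u) := by
  rw [perp, map_sub, map_smul, h.map_q]
  module

/-- The deterministic part of the update direction is small near the top eigenvector. -/
lemma SpectralGap.norm_perp_covLin_sq_le (h : SpectralGap μ lam₁ lam₂ q) {u : Vec d}
    (hu : ‖u‖ = 1) : ‖perp u (covLin μ u)‖ ^ 2 ≤ lam₁ ^ 2 * (1 - inner ℝ u q ^ 2) := by
  -- The projection kills `λ₁ u`; what remains is `Σ - λ₁` acting on the part of `u` orthogonal to
  -- `q`, whose squared norm is `Ψ`.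
  have h1 : perp u (covLin μ u) = perp u (covLin μ (perp q u) - lam₁ • perp q u) := by
    conv_lhs => rw [h.covLin_eq u]
    simp only [perp, inner_add_right, real_inner_smul_right, real_inner_self_eq_norm_sq, hu]
    module
  have h2 := (norm_perp_le hu _).trans (h.norm_sub_le (perp q u) (inner_perp_right h.norm_q))
  rw [h1]
  calc _ ≤ (lam₁ * ‖perp q u‖) ^ 2 := by gcongr
    _ = _ := by rw [mul_pow, norm_perp_sq h.norm_q, hu, real_inner_comm]; ring

/-- The mean motion along `q` is proportional to the present coordinate, so after division by that
coordinate it becomes a drift bounded below by the gap. -/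
lemma SpectralGap.inner_covLin_perp (h : SpectralGap μ lam₁ lam₂ q) (u : Vec d) :
    inner ℝ (covLin μ u) (perp u q) =
      inner ℝ u q * (lam₁ - inner ℝ (covLin μ u) u) := by
  rw [perp, inner_sub_right, real_inner_smul_right, covLin_symm, h.map_q, real_inner_smul_right]
  ring

lemma SpectralGap.inner_covLin_self (h : SpectralGap μ lam₁ lam₂ q) {u : Vec d} :
    inner ℝ (covLin μ u) u = lam₁ * inner ℝ u q ^ 2 +
      inner ℝ (covLin μ (perp q u)) (perp q u) := by
  have h1 : u = inner ℝ q u • q + perp q u := by rw [perp]; module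
  have h2 : inner ℝ q (perp q u) = 0 := inner_perp_left h.norm_q u
  have h3 : inner ℝ (covLin μ (perp q u)) q = 0 := by
    rw [covLin_symm, h.map_q, real_inner_smul_right, real_inner_comm, h2, mul_zero]
  conv_lhs => rw [h1]
  rw [map_add, map_smul, h.map_q]
  simp only [inner_add_left, inner_add_right, real_inner_smul_left, real_inner_smul_right, h2, h3,
    real_inner_self_eq_norm_sq, h.norm_q]
  rw [real_inner_comm u q]
  ring

lemma SpectralGap.gap_mul_le (h : SpectralGap μ lam₁ lam₂ q) {u : Vec d} (hu : ‖u‖ = 1) :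
    (lam₁ - lam₂) * (1 - inner ℝ u q ^ 2) ≤ lam₁ - inner ℝ (covLin μ u) u := by
  have h1 := h.inner_le (perp q u) (inner_perp_right h.norm_q)
  rw [norm_perp_sq h.norm_q, hu, real_inner_comm u q] at h1
  rw [h.inner_covLin_self]
  linarith

lemma SpectralGap.sub_inner_le [IsProbabilityMeasure μ] (h : SpectralGap μ lam₁ lam₂ q) (hb : ∀ᵐ x ∂μ, ‖x‖ ≤ r)
    (u : Vec d) : lam₁ - inner ℝ (covLin μ u) u ≤ lam₁ * (1 - inner ℝ u q ^ 2) := by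
  have h1 := inner_covLin_self_nonneg hb (perp q u)
  rw [h.inner_covLin_self]
  linarith

/-- A bound on `1 / (1 - Ψ)` after one step, for one realization of the mini-batch. -/
lemma SpectralGap.inv_one_sub_potential_step_le [IsProbabilityMeasure μ] (h : SpectralGap μ lam₁ lam₂ q)
    (hb : ∀ᵐ x ∂μ, ‖x‖ ≤ r) {u : Vec d} (hu : ‖u‖ = 1) {ε γ : ℝ} (hε : 0 < ε)
    (hεu : ε ≤ inner ℝ u q ^ 2) (hγ : 0 ≤ γ) (hγε : γ * r ^ 2 ≤ √ε / 4)
    {z : Fin N × Fin b → Vec d} (hz : ∀ p, ‖z p‖ ≤ r) :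
    0 < 1 - potential q (step γ z u) ∧
    1 / (1 - potential q (step γ z u)) ≤
      1 / inner ℝ u q ^ 2 * (1 - 2 * γ * (inner ℝ (sampleLin z u) (perp u q) / inner ℝ u q)
        + 12 * γ ^ 2 * lam₁ ^ 2 * (1 - inner ℝ u q ^ 2) ^ 2
        + 12 * γ ^ 2 * frobSq (sampleCov z - covMatrix μ) * (1 - inner ℝ u q ^ 2) *
            (1 / inner ℝ u q ^ 2)
        + 4 * γ ^ 2 * lam₁ ^ 2 * (1 - inner ℝ u q ^ 2)
        + 4 * γ ^ 2 * frobSq (sampleCov z - covMatrix μ)) := by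
  set a := inner ℝ u q with ha
  set F := frobSq (sampleCov z - covMatrix μ)
  set η := perp u (sampleLin z u)
  set g := inner ℝ (sampleLin z u) (perp u q)
  set ζ := Matrix.toEuclideanLin (sampleCov z - covMatrix μ) u
  have hF0 : 0 ≤ F := frobSq_nonneg _
  have hsplit : sampleLin z u = covLin μ u + ζ := by
    simp only [ζ, map_sub, LinearMap.sub_apply, toEuclideanLin_sampleCov, covLin]
    abel
  have hζ : ‖ζ‖ ^ 2 ≤ F := by
    have := norm_toEuclideanLin_sq_le (sampleCov z - covMatrix μ) u
    rwa [hu, one_pow, mul_one] at this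
  have ha2 : 0 < a ^ 2 := hε.trans_le hεu
  have ha0 : a ≠ 0 := by intro h0; rw [h0] at ha2; norm_num at ha2
  have hΨ : 0 ≤ 1 - a ^ 2 := by
    have := abs_real_inner_le_norm u q
    rw [hu, h.norm_q, one_mul, ← ha] at this
    have := (sq_le_one_iff_abs_le_one a).2 this
    linarith
  have hpq : ‖perp u q‖ ^ 2 = 1 - a ^ 2 := by
    rw [norm_perp_sq hu, h.norm_q]; ring
  -- Signal and noise are separated: the signal carries a factor `Ψ = 1 - a ^ 2`, and only the noise
  -- survives near `q`.
  have hη2 : ‖η‖ ^ 2 ≤ 2 * (lam₁ ^ 2 * (1 - a ^ 2)) + 2 * F := by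
    have e1 : η = perp u (covLin μ u) + perp u ζ := by
      simp only [η, hsplit, perp, inner_add_right]; module
    have e2 := h.norm_perp_covLin_sq_le hu
    have e3 : ‖perp u ζ‖ ^ 2 ≤ F := by
      refine le_trans ?_ hζ
      gcongr
      exact norm_perp_le hu _
    have e4 : ‖η‖ ≤ ‖perp u (covLin μ u)‖ + ‖perp u ζ‖ := e1 ▸ norm_add_le _ _
    nlinarith [norm_nonneg η, sq_nonneg (‖perp u (covLin μ u)‖ - ‖perp u ζ‖)]
  have hg2 : g ^ 2 ≤ 2 * (a ^ 2 * (lam₁ ^ 2 * (1 - a ^ 2) ^ 2)) + 2 * (F * (1 - a ^ 2)) := by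
    have e1 : g = a * (lam₁ - inner ℝ (covLin μ u) u) + inner ℝ ζ (perp u q) := by
      simp only [g, hsplit, inner_add_left, h.inner_covLin_perp]; rfl
    have e2 : (inner ℝ ζ (perp u q)) ^ 2 ≤ F * (1 - a ^ 2) := by
      have := abs_real_inner_le_norm ζ (perp u q)
      calc _ = |inner ℝ ζ (perp u q)| ^ 2 := (sq_abs _).symm
        _ ≤ (‖ζ‖ * ‖perp u q‖) ^ 2 := by gcongr
        _ = ‖ζ‖ ^ 2 * (1 - a ^ 2) := by rw [mul_pow, hpq]
        _ ≤ _ := by gcongr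
    have e3 : (lam₁ - inner ℝ (covLin μ u) u) ^ 2 ≤ lam₁ ^ 2 * (1 - a ^ 2) ^ 2 := by
      rw [← mul_pow]
      have e4 : 0 ≤ lam₁ - inner ℝ (covLin μ u) u :=
        le_trans (mul_nonneg (by linarith [h.lt]) hΨ) (h.gap_mul_le hu)
      have e5 := h.sub_inner_le hb u
      gcongr
    have e6 := mul_le_mul_of_nonneg_left e3 ha2.le
    rw [e1]
    nlinarith [sq_nonneg (a * (lam₁ - inner ℝ (covLin μ u) u) - inner ℝ ζ (perp u q))]
  have hgabs : |g| ≤ r ^ 2 := by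
    have e1 := abs_real_inner_le_norm (sampleLin z u) (perp u q)
    have e2 := norm_sampleLin_le hz u
    rw [hu, mul_one] at e2
    have e3 := norm_perp_le hu q
    rw [h.norm_q] at e3
    calc |g| ≤ r ^ 2 * 1 := e1.trans (mul_le_mul e2 e3 (norm_nonneg _) (by positivity))
      _ = _ := mul_one _
  have haε : √ε ≤ |a| := by
    rw [← Real.sqrt_sq_eq_abs]; exact Real.sqrt_le_sqrt hεu
  -- The relative change of the coordinate along `q`. As `|g| ≤ r ^ 2` and `|a| ≥ √ε`, the step size
  -- condition gives `|ρ| ≤ 1 / 4`.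
  set ρ := γ * (g / a) with hρ
  have hρabs : |ρ| ≤ 1 / 4 := by
    rw [hρ, abs_mul, abs_div, abs_of_nonneg hγ, ← mul_div_assoc,
      div_le_iff₀ (abs_pos.2 ha0)]
    have := mul_le_mul_of_nonneg_left hgabs hγ
    linarith
  obtain ⟨hρ1, hρ2⟩ := abs_le.1 hρabs
  have hx : 1 - potential q (step γ z u) = a ^ 2 * (1 + ρ) ^ 2 / (1 + γ ^ 2 * ‖η‖ ^ 2) := by
    rw [one_sub_potential_step γ z hu, ← mul_pow]
    congr 2
    rw [hρ]
    field_simp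
    rfl
  have hρpos : 0 < (1 + ρ) ^ 2 := by nlinarith
  refine ⟨by rw [hx]; positivity, ?_⟩
  have e1 := inv_one_add_sq_le hρabs
  have e2 := inv_one_add_sq_le_two hρabs
  have e3 : 1 / (1 - potential q (step γ z u)) =
      1 / a ^ 2 * (1 / (1 + ρ) ^ 2 + γ ^ 2 * ‖η‖ ^ 2 * (1 / (1 + ρ) ^ 2)) := by
    rw [hx]; field_simp
  rw [e3]
  refine mul_le_mul_of_nonneg_left ?_ (by positivity)
  have e4 : γ ^ 2 * ‖η‖ ^ 2 * (1 / (1 + ρ) ^ 2) ≤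
      γ ^ 2 * (2 * (lam₁ ^ 2 * (1 - a ^ 2)) + 2 * F) * 2 := by gcongr
  have e5 : ρ ^ 2 ≤ γ ^ 2 * (2 * (lam₁ ^ 2 * (1 - a ^ 2) ^ 2) + 2 * (F * (1 - a ^ 2)) * (1 / a ^ 2)) := by
    have : ρ ^ 2 = γ ^ 2 * (g ^ 2 * (1 / a ^ 2)) := by rw [hρ]; field_simp
    rw [this]
    refine mul_le_mul_of_nonneg_left ?_ (sq_nonneg _)
    calc _ ≤ (2 * (a ^ 2 * (lam₁ ^ 2 * (1 - a ^ 2) ^ 2)) + 2 * (F * (1 - a ^ 2))) * (1 / a ^ 2) := by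
          gcongr
      _ = _ := by field_simp
  have e6 : ρ = γ * (g / a) := rfl
  nlinarith

end OneStep

/-! ### Moments of the mini-batch covariance matrix -/

section Block

variable {d N b : ℕ} {μ : Measure (Vec d)} [IsProbabilityMeasure μ] {r lam₁ lam₂ : ℝ} {q : Vec d}

lemma ae_block_norm_le (N b : ℕ) (hb : ∀ᵐ x ∂μ, ‖x‖ ≤ r) :
    ∀ᵐ z ∂(Measure.pi fun _ : Fin N × Fin b => μ), ∀ p, ‖z p‖ ≤ r := by
  rw [ae_all_iff]
  intro p
  exact (measurePreserving_eval (fun _ : Fin N × Fin b => μ) p).quasiMeasurePreserving.ae hb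

lemma sampleCov_apply (z : Fin N × Fin b → Vec d) (i j : Fin d) :
    sampleCov z i j = ((N * b : ℕ) : ℝ)⁻¹ * ∑ p, outer (z p) i j := by
  simp [sampleCov, Matrix.sum_apply, Fintype.sum_prod_type]

lemma measurable_sampleCov (i j : Fin d) :
    Measurable fun z : Fin N × Fin b → Vec d => sampleCov z i j := by
  simp only [sampleCov_apply]
  refine Measurable.const_mul (Finset.measurable_sum _ fun p _ => ?_) _
  exact (measurable_outer i j).comp (measurable_pi_apply p)

lemma integrable_outer_eval (hb : ∀ᵐ x ∂μ, ‖x‖ ≤ r) (i j : Fin d) (p : Fin N × Fin b) :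
    Integrable (fun z => outer (z p) i j) (Measure.pi fun _ : Fin N × Fin b => μ) :=
  (measurePreserving_eval (fun _ : Fin N × Fin b => μ) p).integrable_comp_of_integrable
    (integrable_outer hb i j)

lemma integrable_sampleCov (hb : ∀ᵐ x ∂μ, ‖x‖ ≤ r) (i j : Fin d) :
    Integrable (fun z => sampleCov z i j) (Measure.pi fun _ : Fin N × Fin b => μ) := by
  simp only [sampleCov_apply]
  exact (integrable_finsetSum _ fun p _ => integrable_outer_eval hb i j p).const_mul _

lemma integral_outer_eval (i j : Fin d) (p : Fin N × Fin b) :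
    ∫ z, outer (z p) i j ∂(Measure.pi fun _ : Fin N × Fin b => μ) = covMatrix μ i j := by
  have := integral_comp_eval (μ := fun _ : Fin N × Fin b => μ) (i := p)
    (f := fun x => outer x i j) (measurable_outer i j).aestronglyMeasurable
  exact this

lemma integral_sampleCov (hN : 1 ≤ N) (hb1 : 1 ≤ b) (hb : ∀ᵐ x ∂μ, ‖x‖ ≤ r) (i j : Fin d) :
    ∫ z, sampleCov z i j ∂(Measure.pi fun _ : Fin N × Fin b => μ) = covMatrix μ i j := by
  have hN0 : (N : ℝ) ≠ 0 := by positivity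
  have hb0 : (b : ℝ) ≠ 0 := by positivity
  simp only [sampleCov_apply]
  rw [integral_const_mul, integral_finsetSum _ fun p _ => integrable_outer_eval hb i j p]
  simp only [integral_outer_eval, Finset.sum_const, Finset.card_univ, Fintype.card_prod,
    Fintype.card_fin, nsmul_eq_mul]
  push_cast
  field_simp

lemma integrable_sampleCov_sub_sq (hb : ∀ᵐ x ∂μ, ‖x‖ ≤ r) (i j : Fin d) (m : ℝ) :
    Integrable (fun z => (sampleCov z i j - m) ^ 2) (Measure.pi fun _ : Fin N × Fin b => μ) := by
  refine Integrable.of_bound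
    (((measurable_sampleCov i j).sub_const m).pow_const 2).aestronglyMeasurable
    ((|((N * b : ℕ) : ℝ)⁻¹| * ∑ p : Fin N × Fin b, r ^ 2 + |m|) ^ 2) ?_
  filter_upwards [ae_block_norm_le N b hb] with z hz
  rw [Real.norm_eq_abs, abs_pow]
  gcongr
  refine (abs_sub _ _).trans (add_le_add_left ?_ _)
  rw [sampleCov_apply, abs_mul]
  gcongr
  exact (Finset.abs_sum_le_sum_abs _ _).trans (Finset.sum_le_sum fun p _ => abs_outer_le (hz p) i j)

lemma integrable_frobSq (hb : ∀ᵐ x ∂μ, ‖x‖ ≤ r) :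
    Integrable (fun z => frobSq (sampleCov z - covMatrix μ))
      (Measure.pi fun _ : Fin N × Fin b => μ) := by
  simp only [frobSq, Matrix.sub_apply]
  exact integrable_finsetSum _ fun i _ => integrable_finsetSum _ fun j _ =>
    integrable_sampleCov_sub_sq hb i j _

lemma integral_frobSq (μ : Measure (Vec d)) : ∫ z, frobSq (sampleCov z - covMatrix μ)
    ∂(Measure.pi fun _ : Fin N × Fin b => μ) = sigmaBSq μ N b := rfl

lemma sigmaBSq_nonneg (μ : Measure (Vec d)) (N b : ℕ) : 0 ≤ sigmaBSq μ N b :=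
  integral_nonneg fun _ => frobSq_nonneg _

lemma sigmaSq_nonneg (μ : Measure (Vec d)) : 0 ≤ sigmaSq μ :=
  integral_nonneg fun _ => frobSq_nonneg _

/-- The variance of the mini-batch sample covariance matrix is `σ² / B`. -/
lemma sigmaBSq_mul (hN : 1 ≤ N) (hb1 : 1 ≤ b) (hb : ∀ᵐ x ∂μ, ‖x‖ ≤ r) :
    sigmaBSq μ N b * ((N * b : ℕ) : ℝ) = sigmaSq μ := by
  have hN0 : (N : ℝ) ≠ 0 := by positivity
  have hb0 : (b : ℝ) ≠ 0 := by positivity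
  have hmem : ∀ i j, MemLp (fun x => outer x i j) 2 μ := fun i j =>
    MemLp.of_bound (measurable_outer i j).aestronglyMeasurable (r ^ 2) (by
      filter_upwards [hb] with x hx
      exact abs_outer_le hx i j)
  have hvar : ∀ i j, ∫ x, (outer x i j - covMatrix μ i j) ^ 2 ∂μ =
      variance (fun x => outer x i j) μ := by
    intro i j
    rw [variance_eq_integral (measurable_outer i j).aemeasurable]
    rfl
  have hvarB : ∀ i j, (∫ z, (sampleCov z i j - covMatrix μ i j) ^ 2
      ∂(Measure.pi fun _ : Fin N × Fin b => μ)) * ((N * b : ℕ) : ℝ) =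
      variance (fun x => outer x i j) μ := by
    intro i j
    have h1 := variance_eq_integral (μ := Measure.pi fun _ : Fin N × Fin b => μ)
      (measurable_sampleCov (N := N) (b := b) i j).aemeasurable
    rw [integral_sampleCov hN hb1 hb] at h1
    rw [← h1]
    simp only [sampleCov_apply]
    rw [variance_const_mul]
    -- Variances of independent samples add, entry by entry; the prefactor `B⁻¹` squared leaves one
    -- division by `B`.
    have h2 := variance_sum_pi (μ := fun _ : Fin N × Fin b => μ)
      (X := fun _ x => outer x i j) (fun _ => hmem i j)
    have h3 : (∑ p : Fin N × Fin b, fun z : Fin N × Fin b → Vec d => outer (z p) i j) =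
        fun z => ∑ p, outer (z p) i j := by
      ext z; simp
    rw [h3] at h2
    rw [h2]
    simp only [Finset.sum_const, Finset.card_univ, Fintype.card_prod, Fintype.card_fin,
      nsmul_eq_mul]
    push_cast
    field_simp
  have hint : ∀ i j, Integrable (fun x => (outer x i j - covMatrix μ i j) ^ 2) μ := fun i j =>
    ((hmem i j).sub (memLp_const _)).integrable_sq
  have hintB : ∀ i j, Integrable (fun z : Fin N × Fin b → Vec d =>
      (sampleCov z i j - covMatrix μ i j) ^ 2) (Measure.pi fun _ : Fin N × Fin b => μ) :=
    fun i j => integrable_sampleCov_sub_sq hb i j _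
  rw [← integral_frobSq μ, sigmaSq]
  simp only [frobSq, Matrix.sub_apply]
  rw [integral_finsetSum _ fun i _ => integrable_finsetSum _ fun j _ =>
    hintB i j, integral_finsetSum _ fun i _ =>
    integrable_finsetSum _ fun j _ => hint i j, Finset.sum_mul]
  refine Finset.sum_congr rfl fun i _ => ?_
  rw [integral_finsetSum _ fun j _ => hintB i j,
    integral_finsetSum _ fun j _ => hint i j, Finset.sum_mul]
  refine Finset.sum_congr rfl fun j _ => ?_
  rw [hvarB, hvar]

lemma inner_sampleLin (z : Fin N × Fin b → Vec d) (u h : Vec d) :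
    inner ℝ (sampleLin z u) h = ∑ i, ∑ j, sampleCov z i j * (u j * h i) := by
  rw [← toEuclideanLin_sampleCov, inner_toEuclideanLin]

lemma integrable_inner_sampleLin (hb : ∀ᵐ x ∂μ, ‖x‖ ≤ r) (u h : Vec d) :
    Integrable (fun z => inner ℝ (sampleLin z u) h)
      (Measure.pi fun _ : Fin N × Fin b => μ) := by
  simp only [inner_sampleLin]
  exact integrable_finsetSum _ fun i _ => integrable_finsetSum _ fun j _ =>
    (integrable_sampleCov hb i j).mul_const _

lemma integral_inner_sampleLin (hN : 1 ≤ N) (hb1 : 1 ≤ b) (hb : ∀ᵐ x ∂μ, ‖x‖ ≤ r)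
    (u h : Vec d) : ∫ z, inner ℝ (sampleLin z u) h ∂(Measure.pi fun _ : Fin N × Fin b => μ) =
      inner ℝ (covLin μ u) h := by
  rw [covLin, inner_toEuclideanLin]
  simp only [inner_sampleLin]
  rw [integral_finsetSum _ fun i _ => integrable_finsetSum _ fun j _ =>
    (integrable_sampleCov hb i j).mul_const _]
  refine Finset.sum_congr rfl fun i _ => ?_
  rw [integral_finsetSum _ fun j _ => (integrable_sampleCov hb i j).mul_const _]
  refine Finset.sum_congr rfl fun j _ => ?_
  rw [integral_mul_const, integral_sampleCov hN hb1 hb]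

end Block

/-! ### Contraction of the expected odds -/

section Odds

variable {d N b : ℕ} {μ : Measure (Vec d)} [IsProbabilityMeasure μ] {r lam₁ lam₂ : ℝ} {q : Vec d}

/-- The odds `ψ / (1 - ψ)`, equal to `∞` at `ψ = 1`. -/
noncomputable def odds (ψ : ℝ) : ENNReal := ENNReal.ofReal ψ / ENNReal.ofReal (1 - ψ)

lemma odds_mono : Monotone odds := by
  intro x y hxy
  exact ENNReal.div_le_div (ENNReal.ofReal_le_ofReal hxy) (ENNReal.ofReal_le_ofReal (by linarith))

lemma odds_eq {ψ : ℝ} (h : 0 < 1 - ψ) : odds ψ = ENNReal.ofReal (1 / (1 - ψ) - 1) := by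
  rw [odds, ← ENNReal.ofReal_div_of_pos h]
  congr 1
  field_simp
  ring

/-- The denominator is at most `1`. This carries the final bound from the odds back to `Ψ`. -/
lemma ofReal_le_odds {ψ : ℝ} (h : 0 ≤ ψ) : ENNReal.ofReal ψ ≤ odds ψ := by
  calc ENNReal.ofReal ψ = ENNReal.ofReal ψ / 1 := (div_one _).symm
    _ ≤ odds ψ := ENNReal.div_le_div le_rfl (ENNReal.ofReal_le_one.2 (by linarith))

lemma measurable_odds : Measurable odds := by
  unfold odds
  fun_prop

lemma potential_le_one (q v : Vec d) : potential q v ≤ 1 := by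
  rw [potential]
  have : 0 ≤ inner ℝ v q ^ 2 / ‖v‖ ^ 2 := by positivity
  linarith

lemma potential_nonneg (hq : ‖q‖ = 1) (v : Vec d) : 0 ≤ potential q v := by
  rw [potential, sub_nonneg]
  have h := abs_real_inner_le_norm v q
  rw [hq, mul_one] at h
  refine div_le_one_of_le₀ ?_ (sq_nonneg _)
  rw [← sq_abs]
  gcongr

lemma integral_affine_comb {α : Type*} [MeasurableSpace α] {ν : Measure α}
    [IsProbabilityMeasure ν] {f g : α → ℝ} (hf : Integrable f ν) (hg : Integrable g ν)
    (A B C : ℝ) :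
    ∫ z, (C + (A * f z + B * g z)) ∂ν = C + (A * ∫ z, f z ∂ν + B * ∫ z, g z ∂ν) := by
  have h1 : Integrable (fun z => A * f z + B * g z) ν := (hf.const_mul A).add (hg.const_mul B)
  rw [integral_add (integrable_const C) h1, integral_add (hf.const_mul A) (hg.const_mul B),
    integral_const_mul, integral_const_mul]
  simp

/-- The expected odds after one step. -/
lemma SpectralGap.lintegral_odds_step_le (h : SpectralGap μ lam₁ lam₂ q)
    (hb : ∀ᵐ x ∂μ, ‖x‖ ≤ r) (hN : 1 ≤ N) (hb1 : 1 ≤ b) {ε γ : ℝ} (hε : 0 < ε) (hε1 : ε ≤ 1)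
    (hγ : 0 ≤ γ) (hγε : γ * r ^ 2 ≤ √ε / 4)
    (hα : 0 ≤ 1 - 2 * γ * (lam₁ - lam₂) + 16 * γ ^ 2 * (lam₁ ^ 2 + sigmaBSq μ N b / ε))
    {v : Vec d} (hv : potential q v ≤ 1 - ε) :
    ∫⁻ z, odds (potential q (step γ z v)) ∂(Measure.pi fun _ : Fin N × Fin b => μ) ≤
      ENNReal.ofReal (1 - 2 * γ * (lam₁ - lam₂) + 16 * γ ^ 2 * (lam₁ ^ 2 + sigmaBSq μ N b / ε)) *
        odds (potential q v) + ENNReal.ofReal (4 * γ ^ 2 * sigmaBSq μ N b) := by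
  -- Division by zero gives the zero vector potential `1`, which the hypothesis excludes.
  have hv0 : v ≠ 0 := by
    rintro rfl
    simp [potential] at hv
    linarith
  have hvn : ‖v‖ ≠ 0 := norm_ne_zero_iff.2 hv0
  set u := ‖v‖⁻¹ • v with hu_def
  have hu : ‖u‖ = 1 := by
    rw [hu_def, norm_smul, norm_inv, norm_norm, inv_mul_cancel₀ hvn]
  have hvu : v = ‖v‖ • u := by rw [hu_def, smul_smul, mul_inv_cancel₀ hvn, one_smul]
  rw [hvu]
  simp only [step_smul _ _ hvn, potential_smul q hvn]
  rw [hvu, potential_smul q hvn] at hv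
  clear_value u
  clear hvu hu_def hvn hv0
  have hpu : potential q u = 1 - inner ℝ u q ^ 2 := by simp [potential, hu]
  set a := inner ℝ u q with ha
  rw [hpu] at hv ⊢
  have hεa : ε ≤ a ^ 2 := by linarith
  have hΨ : 0 ≤ 1 - a ^ 2 := by rw [← hpu]; exact potential_nonneg h.norm_q u
  have ha2 : 0 < a ^ 2 := hε.trans_le hεa
  have ha0 : a ≠ 0 := by intro h0; rw [h0] at ha2; norm_num at ha2
  set σ := sigmaBSq μ N b
  have hσ : 0 ≤ σ := sigmaBSq_nonneg μ N b
  set π := Measure.pi fun _ : Fin N × Fin b => μ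
  -- A majorant of the odds that is affine in the linear term and the Frobenius deviation, so that
  -- its mean is explicit. Nonnegativity almost surely makes its lower and Bochner integrals agree.
  let R : (Fin N × Fin b → Vec d) → ℝ := fun z =>
    1 / a ^ 2 * (1 - 2 * γ * (inner ℝ (sampleLin z u) (perp u q) / a)
        + 12 * γ ^ 2 * lam₁ ^ 2 * (1 - a ^ 2) ^ 2
        + 12 * γ ^ 2 * frobSq (sampleCov z - covMatrix μ) * (1 - a ^ 2) * (1 / a ^ 2)
        + 4 * γ ^ 2 * lam₁ ^ 2 * (1 - a ^ 2)
        + 4 * γ ^ 2 * frobSq (sampleCov z - covMatrix μ)) - 1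
  have hpt : ∀ᵐ z ∂π, odds (potential q (step γ z u)) ≤ ENNReal.ofReal (R z) ∧ 0 ≤ R z := by
    filter_upwards [ae_block_norm_le N b hb] with z hz
    obtain ⟨h1, h2⟩ := h.inv_one_sub_potential_step_le hb hu hε hεa hγ hγε hz
    have h3 : 1 / (1 - potential q (step γ z u)) - 1 ≤ R z := sub_le_sub_right h2 1
    refine ⟨by rw [odds_eq h1]; exact ENNReal.ofReal_le_ofReal h3, le_trans ?_ h3⟩
    rw [sub_nonneg, le_div_iff₀ h1]
    linarith [potential_nonneg h.norm_q (step γ z u)]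
  have hi1 := (integrable_inner_sampleLin (N := N) (b := b) hb u (perp u q))
  have hi2 := (integrable_frobSq (N := N) (b := b) hb)
  have hR : R = fun z => (1 / a ^ 2 * (1 + 12 * γ ^ 2 * lam₁ ^ 2 * (1 - a ^ 2) ^ 2
        + 4 * γ ^ 2 * lam₁ ^ 2 * (1 - a ^ 2)) - 1) +
      ((- (1 / a ^ 2 * (2 * γ / a))) * inner ℝ (sampleLin z u) (perp u q) +
      (1 / a ^ 2 * (12 * γ ^ 2 * (1 - a ^ 2) * (1 / a ^ 2) + 4 * γ ^ 2)) *
        frobSq (sampleCov z - covMatrix μ)) := by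
    funext z
    simp only [R]
    ring
  have hRint : Integrable R π := by
    rw [hR]
    exact (integrable_const _).add ((hi1.const_mul _).add (hi2.const_mul _))
  have hRval : ∫ z, R z ∂π = (1 / a ^ 2 * (1 + 12 * γ ^ 2 * lam₁ ^ 2 * (1 - a ^ 2) ^ 2
        + 4 * γ ^ 2 * lam₁ ^ 2 * (1 - a ^ 2)) - 1) +
      ((- (1 / a ^ 2 * (2 * γ / a))) * (a * (lam₁ - inner ℝ (covLin μ u) u)) +
      (1 / a ^ 2 * (12 * γ ^ 2 * (1 - a ^ 2) * (1 / a ^ 2) + 4 * γ ^ 2)) * σ) := by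
    rw [hR, integral_affine_comb hi1 hi2, integral_inner_sampleLin hN hb1 hb, integral_frobSq μ,
      h.inner_covLin_perp]
  set W := 1 / a ^ 2 - 1 with hW
  have hWΨ : (1 - a ^ 2) * (1 / a ^ 2) = W := by rw [hW]; field_simp
  have hW0 : 0 ≤ W := by rw [← hWΨ]; positivity
  have hYε : 1 / a ^ 2 ≤ 1 / ε := one_div_le_one_div_of_le hε hεa
  have hRle : ∫ z, R z ∂π ≤ (1 - 2 * γ * (lam₁ - lam₂) + 16 * γ ^ 2 * (lam₁ ^ 2 + σ / ε)) * W +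
      4 * γ ^ 2 * σ := by
    have e1 := h.gap_mul_le hu
    rw [← ha] at e1
    have e2 : (1 / a ^ 2) * (2 * γ * ((lam₁ - lam₂) * (1 - a ^ 2))) ≤
        (1 / a ^ 2) * (2 * γ * (lam₁ - inner ℝ (covLin μ u) u)) := by gcongr
    have e3 : (1 / a ^ 2) * (2 * γ * ((lam₁ - lam₂) * (1 - a ^ 2))) =
        2 * γ * (lam₁ - lam₂) * W := by rw [← hWΨ]; ring
    -- Writing `1 / a ^ 2 = 1 + W` in the last noise term isolates the additive `4 γ ^ 2 σ`.
    -- Everything else is a multiple of the odds `W`, and `12 + 4` gives the `16`.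
    have e4 : ∫ z, R z ∂π = W + 12 * γ ^ 2 * lam₁ ^ 2 * ((1 - a ^ 2) * W) +
        4 * γ ^ 2 * lam₁ ^ 2 * W - (1 / a ^ 2) * (2 * γ * (lam₁ - inner ℝ (covLin μ u) u)) +
        12 * γ ^ 2 * σ * ((1 / a ^ 2) * W) + 4 * γ ^ 2 * σ * (1 + W) := by
      rw [hRval, ← hWΨ]
      field_simp
      ring
    have e5 : 12 * γ ^ 2 * lam₁ ^ 2 * ((1 - a ^ 2) * W) ≤ 12 * γ ^ 2 * lam₁ ^ 2 * (1 * W) := by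
      gcongr
      linarith
    have e6 : 12 * γ ^ 2 * σ * ((1 / a ^ 2) * W) ≤ 12 * γ ^ 2 * σ * ((1 / ε) * W) := by gcongr
    have e7 : 4 * γ ^ 2 * σ * (1 * W) ≤ 4 * γ ^ 2 * σ * ((1 / ε) * W) := by
      gcongr
      rw [le_div_iff₀ hε]; linarith
    have e8 : σ / ε = σ * (1 / ε) := by ring
    rw [e4, e8]
    linarith
  calc _ ≤ ∫⁻ z, ENNReal.ofReal (R z) ∂π := lintegral_mono_ae (hpt.mono fun z hz => hz.1)
    _ = ENNReal.ofReal (∫ z, R z ∂π) :=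
      (ofReal_integral_eq_lintegral_ofReal hRint (hpt.mono fun z hz => hz.2)).symm
    _ ≤ _ := ENNReal.ofReal_le_ofReal hRle
    _ = _ := by
      rw [ENNReal.ofReal_add (by positivity) (by positivity), ENNReal.ofReal_mul hα,
        odds_eq (by linarith), sub_sub_cancel]

end Odds

/-! ### Anti-concentration of the uniform starting direction -/

section Sphere

open scoped Pointwise

/-- Log-convexity of the Gamma function at the midpoint of `x` and `x + 1`. -/
lemma Gamma_add_half_le {x : ℝ} (hx : 0 < x) :
    Real.Gamma (x + 1 / 2) ≤ √x * Real.Gamma x := by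
  have h := Real.Gamma_mul_add_mul_le_rpow_Gamma_mul_rpow_Gamma hx (by linarith : 0 < x + 1)
    (by norm_num : (0 : ℝ) < 1 / 2) (by norm_num : (0 : ℝ) < 1 / 2) (by norm_num)
  have hG := Real.Gamma_pos_of_pos hx
  rw [Real.Gamma_add_one hx.ne', ← Real.sqrt_eq_rpow, ← Real.sqrt_eq_rpow,
    Real.sqrt_mul hx.le] at h
  calc _ = Real.Gamma (1 / 2 * x + 1 / 2 * (x + 1)) := by congr 1; ring
    _ ≤ _ := h
    _ = √x * (√(Real.Gamma x) * √(Real.Gamma x)) := by ring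
    _ = _ := by rw [Real.mul_self_sqrt hG.le]

lemma exists_isometry_map {E : Type*} [NormedAddCommGroup E] [InnerProductSpace ℝ E]
    {p q : E} (h : ‖p‖ = ‖q‖) : ∃ φ : E ≃ₗᵢ[ℝ] E, φ p = q :=
  ⟨_, Submodule.reflection_sub h⟩

/-- The volume of a slab of the unit ball around a hyperplane through the origin. -/
lemma volume_slab_le {n : ℕ} {q : Vec (n + 1)} (hq : ‖q‖ = 1) (a : ℝ) :
    volume {w : Vec (n + 1) | |inner ℝ w q| ≤ a ∧ ‖w‖ < 1} ≤
      ENNReal.ofReal (2 * a) * volume (Metric.ball (0 : Vec n) 1) := by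
  -- Rotating `q` to the first coordinate axis puts the slab inside the product of `[-a, a]` and the
  -- unit ball one dimension lower.
  obtain ⟨φ, hφ⟩ := exists_isometry_map (p := q) (q := EuclideanSpace.single (0 : Fin (n + 1)) (1 : ℝ))
    (by simp [hq])
  set B : Set (Fin n → ℝ) := WithLp.toLp 2 ⁻¹' (Metric.ball (0 : Vec n) 1) with hB
  have hBm : MeasurableSet B := (WithLp.measurable_toLp 2 _) measurableSet_ball
  have hBv : volume B = volume (Metric.ball (0 : Vec n) 1) :=
    (PiLp.volume_preserving_toLp (Fin n)).measure_preimage measurableSet_ball.nullMeasurableSet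
  set A : Set (Fin (n + 1) → ℝ) :=
    MeasurableEquiv.piFinSuccAbove (fun _ => ℝ) 0 ⁻¹' (Set.Icc (-a) a ×ˢ B) with hA
  have hAm : MeasurableSet A :=
    (MeasurableEquiv.piFinSuccAbove (fun _ => ℝ) 0).measurable (measurableSet_Icc.prod hBm)
  have hAv : volume A = ENNReal.ofReal (2 * a) * volume (Metric.ball (0 : Vec n) 1) := by
    rw [hA, (volume_preserving_piFinSuccAbove (fun _ : Fin (n + 1) => ℝ) 0).measure_preimage
      (measurableSet_Icc.prod hBm).nullMeasurableSet, Measure.volume_eq_prod, Measure.prod_prod,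
      Real.volume_Icc, hBv]
    congr 2
    ring
  have hmp := (PiLp.volume_preserving_ofLp (Fin (n + 1))).comp φ.measurePreserving
  rw [← hAv, ← hmp.measure_preimage hAm.nullMeasurableSet]
  refine measure_mono ?_
  rintro w ⟨h1, h2⟩
  have h3 : inner ℝ w q = φ w 0 := by
    rw [← φ.inner_map_map, hφ]
    simp [EuclideanSpace.inner_single_right]
  have h4 : ‖φ w‖ < 1 := by rwa [φ.norm_map]
  rw [h3] at h1
  refine ⟨abs_le.1 h1, ?_⟩
  simp only [hB, Set.mem_preimage, mem_ball_zero_iff]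
  refine lt_of_le_of_lt ?_ h4
  refine (sq_le_sq₀ (norm_nonneg _) (norm_nonneg _)).1 ?_
  rw [EuclideanSpace.norm_sq_eq, EuclideanSpace.norm_sq_eq, Fin.sum_univ_succ]
  have : 0 ≤ ‖φ w 0‖ ^ 2 := by positivity
  simp [MeasurableEquiv.piFinSuccAbove, Fin.insertNthEquiv, Fin.tail]
  positivity

lemma volume_ball_le_succ {n : ℕ} (hn : 1 ≤ n) :
    volume (Metric.ball (0 : Vec n) 1) ≤
      ENNReal.ofReal (√((n + 2) / (2 * Real.pi))) * volume (Metric.ball (0 : Vec (n + 1)) 1) := by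
  have hV : ∀ m : ℕ, 1 ≤ m → volume (Metric.ball (0 : Vec m) 1) =
      ENNReal.ofReal (√Real.pi ^ m / Real.Gamma (m / 2 + 1)) := by
    intro m hm
    have : Nonempty (Fin m) := ⟨⟨0, hm⟩⟩
    rw [EuclideanSpace.volume_ball]
    simp
  rw [hV n hn, hV (n + 1) (by omega), ← ENNReal.ofReal_mul (by positivity)]
  refine ENNReal.ofReal_le_ofReal ?_
  have hG := Gamma_add_half_le (x := n / 2 + 1) (by positivity)
  have hG1 : 0 < Real.Gamma (n / 2 + 1) := Real.Gamma_pos_of_pos (by positivity)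
  have hG2 : 0 < Real.Gamma (n / 2 + 1 + 1 / 2) := Real.Gamma_pos_of_pos (by positivity)
  have e1 : ((n + 1 : ℕ) : ℝ) / 2 + 1 = n / 2 + 1 + 1 / 2 := by push_cast; ring
  have e2 : ((n : ℝ) + 2) / (2 * Real.pi) = (n / 2 + 1) / Real.pi := by field_simp
  rw [e1, e2, Real.sqrt_div (by positivity)]
  have hpi : 0 < √Real.pi := Real.sqrt_pos.2 Real.pi_pos
  rw [pow_succ]
  have e3 : √((n : ℝ) / 2 + 1) / √Real.pi * (√Real.pi ^ n * √Real.pi / Real.Gamma (n / 2 + 1 + 1 / 2))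
     = √((n : ℝ) / 2 + 1) * √Real.pi ^ n / Real.Gamma (n / 2 + 1 + 1 / 2) := by
    field_simp
  rw [e3, div_le_div_iff₀ hG1 hG2]
  nlinarith [pow_pos hpi n]

/-- Anti-concentration of a uniform random direction along a fixed direction. -/
lemma uniformSphere_potential_gt_le {d : ℕ} (hd : 2 ≤ d) {q : Vec d} (hq : ‖q‖ = 1) {s : ℝ}
    (hs : 0 ≤ s) :
    uniformSphere d {v | 1 - s < potential q v} ≤ ENNReal.ofReal (√(s * d)) := by
  obtain ⟨n, rfl⟩ : ∃ n, d = n + 1 := ⟨d - 1, by omega⟩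
  have hpm : Measurable fun v : Vec (n + 1) => potential q v := by
    unfold potential
    fun_prop
  have hm : MeasurableSet {v : Vec (n + 1) | 1 - s < potential q v} :=
    measurableSet_lt measurable_const hpm
  have hm' : MeasurableSet (Subtype.val ⁻¹' {v : Vec (n + 1) | 1 - s < potential q v} :
      Set (Metric.sphere (0 : Vec (n + 1)) 1)) := measurable_subtype_coe hm
  rw [uniformSphere, Measure.map_apply measurable_subtype_coe hm, Measure.smul_apply,
    Measure.toSphere_apply' _ hm', Measure.toSphere_apply_univ, smul_eq_mul]
  set V := volume (Metric.ball (0 : Vec (n + 1)) 1) with hV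
  have hV0 : V ≠ 0 := (Metric.measure_ball_pos _ _ one_pos).ne'
  have hVt : V ≠ ⊤ := measure_ball_lt_top.ne
  -- The surface measure is the dimension times the volume of the cone over the set, and shrinking a
  -- vector keeps it in the slab.
  have hsub : Set.Ioo (0 : ℝ) 1 • ((Subtype.val : Metric.sphere (0 : Vec (n + 1)) 1 → _) ''
      (Subtype.val ⁻¹' {v : Vec (n + 1) | 1 - s < potential q v})) ⊆
      {w : Vec (n + 1) | |inner ℝ w q| ≤ √s ∧ ‖w‖ < 1} := by
    rintro _ ⟨t, ht, _, ⟨⟨v, hv⟩, hv2, rfl⟩, rfl⟩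
    have hv1 : ‖v‖ = 1 := by simpa using hv
    simp only [Set.mem_preimage, Set.mem_ofPred_eq, potential, hv1] at hv2
    have h1 : |inner ℝ v q| ≤ √s := by
      apply Real.abs_le_sqrt
      linarith
    refine ⟨?_, ?_⟩
    · simp only [real_inner_smul_left, abs_mul, abs_of_pos ht.1]
      nlinarith [ht.2, abs_nonneg (inner ℝ v q)]
    · simp only [norm_smul, hv1, Real.norm_eq_abs, abs_of_pos ht.1]
      linarith [ht.2]
  have hvol : volume (Set.Ioo (0 : ℝ) 1 • ((Subtype.val : Metric.sphere (0 : Vec (n + 1)) 1 → _) ''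
      (Subtype.val ⁻¹' {v : Vec (n + 1) | 1 - s < potential q v}))) ≤
      ENNReal.ofReal (√(s * (n + 1 : ℕ))) * V := by
    refine (measure_mono hsub).trans ((volume_slab_le hq (√s)).trans ?_)
    refine (mul_le_mul_right (volume_ball_le_succ (by omega)) _).trans ?_
    rw [← mul_assoc, ← ENNReal.ofReal_mul (by positivity)]
    refine mul_le_mul_left (ENNReal.ofReal_le_ofReal ?_) _
    rw [Real.sqrt_mul hs, mul_assoc, mul_left_comm]
    refine mul_le_mul_of_nonneg_left ?_ (Real.sqrt_nonneg s)
    refine (sq_le_sq₀ (by positivity) (by positivity)).1 ?_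
    rw [mul_pow, Real.sq_sqrt (by positivity), Real.sq_sqrt (by positivity)]
    -- What remains is `2 (n + 2) / π ≤ n + 1`; with `π > 3` it follows from `n ≥ 1`, that is, `d ≥
    -- 2`.
    have hpi := Real.pi_gt_three
    have hn : (1 : ℝ) ≤ n := by
      have : 1 ≤ n := by omega
      exact_mod_cast this
    push_cast
    rw [← mul_div_assoc, div_le_iff₀ (by positivity)]
    nlinarith
  have hfr : Module.finrank ℝ (Vec (n + 1)) = n + 1 := by simp
  rw [hfr]
  have hc0 : ((n + 1 : ℕ) : ENNReal) ≠ 0 := by simp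
  have hct : ((n + 1 : ℕ) : ENNReal) ≠ ⊤ := ENNReal.natCast_ne_top _
  calc _ ≤ (((n + 1 : ℕ) : ENNReal) * V)⁻¹ *
        (((n + 1 : ℕ) : ENNReal) * (ENNReal.ofReal (√(s * (n + 1 : ℕ))) * V)) := by gcongr
    _ = (((n + 1 : ℕ) : ENNReal) * V)⁻¹ * (((n + 1 : ℕ) : ENNReal) * V) *
        ENNReal.ofReal (√(s * (n + 1 : ℕ))) := by ring
    _ = _ := by rw [ENNReal.inv_mul_cancel (mul_ne_zero hc0 hV0) (ENNReal.mul_ne_top hct hVt), one_mul]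

end Sphere

/-! ### Maximal inequality and conditional means from a one-step recursion -/

section Maximal

variable {Ω : Type*} {Ψ : ℕ → Ω → ℝ}

/-- The event that `Ψ_0, …, Ψ_{t-1}` are at most `1 - ε`. -/
def stayBelow (Ψ : ℕ → Ω → ℝ) (ε : ℝ) (t : ℕ) : Set Ω := {ω | ∀ l < t, Ψ l ω ≤ 1 - ε}

lemma stayBelow_succ (Ψ : ℕ → Ω → ℝ) (ε : ℝ) (t : ℕ) :
    stayBelow Ψ ε (t + 1) = stayBelow Ψ ε t ∩ {ω | Ψ t ω ≤ 1 - ε} := by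
  ext ω
  simp only [stayBelow, Set.mem_inter_iff, Set.mem_ofPred_eq, Nat.lt_succ_iff_lt_or_eq]
  constructor
  · intro h
    exact ⟨fun l hl => h l (Or.inl hl), h t (Or.inr rfl)⟩
  · rintro ⟨h1, h2⟩ l (hl | rfl)
    · exact h1 l hl
    · exact h2

lemma stayBelow_zero (Ψ : ℕ → Ω → ℝ) (ε : ℝ) : stayBelow Ψ ε 0 = Set.univ := by
  ext ω; simp [stayBelow]

lemma stayBelow_antitone (Ψ : ℕ → Ω → ℝ) (ε : ℝ) : Antitone (stayBelow Ψ ε) :=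
  fun _ _ h _ hω l hl => hω l (hl.trans_le h)

variable [MeasurableSpace Ω] {P : Measure Ω}

lemma measurableSet_stayBelow (hΨ : ∀ t, Measurable (Ψ t)) (ε : ℝ) (t : ℕ) :
    MeasurableSet (stayBelow Ψ ε t) := by
  have : stayBelow Ψ ε t = ⋂ l, ⋂ _ : l < t, {ω | Ψ l ω ≤ 1 - ε} := by
    ext ω; simp [stayBelow]
  rw [this]
  exact MeasurableSet.iInter fun l => MeasurableSet.iInter fun _ =>
    measurableSet_le (hΨ l) measurable_const

lemma odds_one_sub {ε : ℝ} (hε : 0 < ε) : odds (1 - ε) = ENNReal.ofReal (1 / ε - 1) := by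
  rw [odds_eq (by linarith)]
  congr 2
  ring

lemma one_add_odds_one_sub {ε : ℝ} (hε : 0 < ε) (hε1 : ε ≤ 1) :
    1 + odds (1 - ε) = ENNReal.ofReal (1 / ε) := by
  have : 1 ≤ 1 / ε := by rw [le_div_iff₀ hε]; linarith
  rw [odds_one_sub hε, ← ENNReal.ofReal_one, ← ENNReal.ofReal_add zero_le_one (by linarith)]
  congr 1
  ring

/-- Conditioning on a function being small does not increase its mean. -/
lemma setLIntegral_inter_le [IsFiniteMeasure P] {f : Ω → ENNReal} (hf : Measurable f) {A C : Set Ω}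
    (hC : MeasurableSet C) {w m : ENNReal} (hm : m ≠ ⊤)
    (h1 : ∀ ω ∈ C, f ω ≤ w) (h2 : ∀ ω ∉ C, w ≤ f ω) (h : ∫⁻ ω in A, f ω ∂P ≤ m * P A) :
    ∫⁻ ω in A ∩ C, f ω ∂P ≤ m * P (A ∩ C) := by
  -- If the threshold `w` is at most `m`, then `f ≤ m` on `C` pointwise. Otherwise the removed part
  -- has `f ≥ m`, and subtracting it lowers the integral by at least its share of `m`.
  rcases le_total w m with hwm | hwm
  · calc _ ≤ ∫⁻ _ in A ∩ C, m ∂P :=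
          setLIntegral_mono measurable_const fun ω hω => (h1 ω hω.2).trans hwm
      _ = _ := setLIntegral_const _ _
  · have e1 : ∫⁻ ω in A ∩ C, f ω ∂P + ∫⁻ ω in A \ C, f ω ∂P = ∫⁻ ω in A, f ω ∂P :=
      lintegral_inter_add_sdiff f A hC
    have e2 : P (A ∩ C) + P (A \ C) = P A := measure_inter_add_sdiff A hC
    have e3 : m * P (A \ C) ≤ ∫⁻ ω in A \ C, f ω ∂P := by
      rw [← setLIntegral_const]
      exact setLIntegral_mono hf fun ω hω => hwm.trans (h2 ω hω.2)
    rw [← e1, ← e2, mul_add] at h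
    have e4 : m * P (A \ C) ≠ ⊤ := ENNReal.mul_ne_top hm (measure_ne_top _ _)
    refine ENNReal.le_of_add_le_add_right e4 (le_trans ?_ h)
    gcongr

/-- The conditional mean of the odds, from a one-step recursion. -/
lemma setLIntegral_odds_le [IsFiniteMeasure P] (hΨ : ∀ t, Measurable (Ψ t)) {ε : ℝ} (hε : 0 < ε)
    {α β m : ℕ → ℝ} (hm0 : 1 / ε ≤ m 0)
    (hα : ∀ t, 0 ≤ α (t + 1)) (hβ : ∀ t, 0 ≤ β (t + 1)) (hmnn : ∀ t, 0 ≤ m t)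
    (hm : ∀ t, α (t + 1) * m t + β (t + 1) ≤ m (t + 1))
    (hstep : ∀ t, ∫⁻ ω in stayBelow Ψ ε (t + 1), odds (Ψ (t + 1) ω) ∂P ≤
      ENNReal.ofReal (α (t + 1)) * ∫⁻ ω in stayBelow Ψ ε (t + 1), odds (Ψ t ω) ∂P +
        ENNReal.ofReal (β (t + 1)) * P (stayBelow Ψ ε (t + 1))) (t : ℕ) :
    ∫⁻ ω in stayBelow Ψ ε (t + 1), odds (Ψ (t + 1) ω) ∂P ≤
      ENNReal.ofReal (m (t + 1)) * P (stayBelow Ψ ε (t + 1)) := by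
  have hnext : ∀ t, ∫⁻ ω in stayBelow Ψ ε (t + 1), odds (Ψ t ω) ∂P ≤
      ENNReal.ofReal (m t) * P (stayBelow Ψ ε (t + 1)) →
      ∫⁻ ω in stayBelow Ψ ε (t + 1), odds (Ψ (t + 1) ω) ∂P ≤
      ENNReal.ofReal (m (t + 1)) * P (stayBelow Ψ ε (t + 1)) := by
    intro t ht
    refine (hstep t).trans ?_
    calc _ ≤ ENNReal.ofReal (α (t + 1)) * (ENNReal.ofReal (m t) * P (stayBelow Ψ ε (t + 1))) +
          ENNReal.ofReal (β (t + 1)) * P (stayBelow Ψ ε (t + 1)) := by gcongr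
      _ = ENNReal.ofReal (α (t + 1) * m t + β (t + 1)) * P (stayBelow Ψ ε (t + 1)) := by
        rw [ENNReal.ofReal_add (mul_nonneg (hα t) (hmnn t)) (hβ t), ENNReal.ofReal_mul (hα t)]
        ring
      _ ≤ _ := by gcongr; exact hm t
  -- The induction runs on the bound just before a step. The new value is still unconstrained after
  -- the step, and imposing `Ψ ≤ 1 - ε` on it is the conditioning that does not raise the mean.
  refine hnext t ?_
  induction t with
  | zero =>
    rw [← setLIntegral_const]
    refine setLIntegral_mono measurable_const fun ω hω => ?_
    refine (odds_mono (hω 0 (by omega))).trans ?_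
    rw [odds_one_sub hε]
    exact ENNReal.ofReal_le_ofReal (by linarith)
  | succ t ih =>
    rw [stayBelow_succ Ψ ε (t + 1)]
    refine setLIntegral_inter_le (w := odds (1 - ε)) (measurable_odds.comp (hΨ _))
      (measurableSet_le (hΨ _) measurable_const)
      ENNReal.ofReal_ne_top (fun ω hω => odds_mono hω) (fun ω hω => odds_mono ?_) (hnext t ih)
    exact (not_le.1 hω).le

/-- A maximal inequality for the odds, from a one-step recursion. -/
lemma measure_sdiff_stayBelow_le [IsProbabilityMeasure P] (hΨ : ∀ t, Measurable (Ψ t)) {ε s : ℝ}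
    (hε : 0 < ε) (hε1 : ε ≤ 1) (hs : 0 < s) (hs1 : s ≤ 1) {κ e : ℕ → ℝ} (he0 : e 0 = 1)
    (hκ : ∀ t, 1 ≤ κ (t + 1)) (he : ∀ t, κ (t + 1) * e t ≤ e (t + 1))
    (hstep : ∀ t, ∫⁻ ω in {ω | Ψ 0 ω ≤ 1 - s} ∩ stayBelow Ψ ε (t + 1), (1 + odds (Ψ (t + 1) ω)) ∂P ≤
      ENNReal.ofReal (κ (t + 1)) *
        ∫⁻ ω in {ω | Ψ 0 ω ≤ 1 - s} ∩ stayBelow Ψ ε (t + 1), (1 + odds (Ψ t ω)) ∂P) (t : ℕ) :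
    P ({ω | Ψ 0 ω ≤ 1 - s} \ stayBelow Ψ ε (t + 1)) ≤ ENNReal.ofReal (ε * e t / s) := by
  set A : ℕ → Set Ω := fun t => {ω | Ψ 0 ω ≤ 1 - s} ∩ stayBelow Ψ ε t with hA
  have hAm : ∀ t, MeasurableSet (A t) := fun t =>
    (measurableSet_le (hΨ 0) measurable_const).inter (measurableSet_stayBelow hΨ ε t)
  have hAanti : ∀ t, A (t + 1) ⊆ A t := fun t =>
    Set.inter_subset_inter_right _ (stayBelow_antitone Ψ ε (Nat.le_succ t))
  have hA0 : A 0 = {ω | Ψ 0 ω ≤ 1 - s} := by simp [hA, stayBelow_zero]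
  have hmY : ∀ t, Measurable fun ω => 1 + odds (Ψ t ω) := fun t =>
    measurable_const.add (measurable_odds.comp (hΨ t))
  -- A path that leaves at time `t` carries `1 + odds ≥ 1 / ε` at that moment.
  have hsplit : ∀ t, ∫⁻ ω in A (t + 1), (1 + odds (Ψ t ω)) ∂P +
      ENNReal.ofReal (1 / ε) * P (A t \ A (t + 1)) ≤ ∫⁻ ω in A t, (1 + odds (Ψ t ω)) ∂P := by
    intro t
    rw [← lintegral_inter_add_sdiff _ (A t) (hAm (t + 1)), Set.inter_eq_right.2 (hAanti t),
      ← setLIntegral_const]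
    refine add_le_add le_rfl ?_
    refine setLIntegral_mono (hmY t) fun ω hω => ?_
    have h1 : 1 - ε ≤ Ψ t ω := by
      by_contra hcon
      refine hω.2 ⟨hω.1.1, ?_⟩
      rw [stayBelow_succ]
      exact ⟨hω.1.2, (not_le.1 hcon).le⟩
    rw [← one_add_odds_one_sub hε hε1]
    exact add_le_add_right (odds_mono h1) 1
  -- The stopped process: the mass still inside plus `1 / ε` for each path that has left. Since `κ ≥
  -- 1`, the growth factor may also be applied to the paths already stopped.
  have key : ∀ t, ∫⁻ ω in A (t + 1), (1 + odds (Ψ t ω)) ∂P +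
      ENNReal.ofReal (1 / ε) * P (A 0 \ A (t + 1)) ≤ ENNReal.ofReal (e t * (1 / s)) := by
    intro t
    induction t with
    | zero =>
      refine (hsplit 0).trans ?_
      calc _ ≤ ∫⁻ _ in A 0, ENNReal.ofReal (1 / s) ∂P := by
            refine setLIntegral_mono measurable_const fun ω hω => ?_
            rw [hA0] at hω
            rw [← one_add_odds_one_sub hs hs1]
            exact add_le_add_right (odds_mono hω) 1
        _ = ENNReal.ofReal (1 / s) * P (A 0) := setLIntegral_const _ _
        _ ≤ ENNReal.ofReal (1 / s) * 1 := by gcongr; exact prob_le_one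
        _ = _ := by rw [he0, one_mul, mul_one]
    | succ t ih =>
      have h1 : P (A 0 \ A (t + 1 + 1)) ≤ P (A (t + 1) \ A (t + 1 + 1)) + P (A 0 \ A (t + 1)) := by
        refine (measure_mono ?_).trans (measure_union_le _ _)
        intro ω hω
        by_cases h : ω ∈ A (t + 1)
        · exact Or.inl ⟨h, hω.2⟩
        · exact Or.inr ⟨hω.1, h⟩
      have hκ1 : (1 : ENNReal) ≤ ENNReal.ofReal (κ (t + 1)) := by
        rw [← ENNReal.ofReal_one]; exact ENNReal.ofReal_le_ofReal (hκ t)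
      calc _ ≤ ∫⁻ ω in A (t + 1 + 1), (1 + odds (Ψ (t + 1) ω)) ∂P +
            ENNReal.ofReal (1 / ε) * (P (A (t + 1) \ A (t + 1 + 1)) + P (A 0 \ A (t + 1))) := by
              gcongr
        _ = (∫⁻ ω in A (t + 1 + 1), (1 + odds (Ψ (t + 1) ω)) ∂P +
            ENNReal.ofReal (1 / ε) * P (A (t + 1) \ A (t + 1 + 1))) +
            1 * (ENNReal.ofReal (1 / ε) * P (A 0 \ A (t + 1))) := by ring
        _ ≤ ENNReal.ofReal (κ (t + 1)) * ∫⁻ ω in A (t + 1), (1 + odds (Ψ t ω)) ∂P +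
            ENNReal.ofReal (κ (t + 1)) * (ENNReal.ofReal (1 / ε) * P (A 0 \ A (t + 1))) := by
              gcongr
              exact (hsplit (t + 1)).trans (hstep t)
        _ = ENNReal.ofReal (κ (t + 1)) * (∫⁻ ω in A (t + 1), (1 + odds (Ψ t ω)) ∂P +
            ENNReal.ofReal (1 / ε) * P (A 0 \ A (t + 1))) := by ring
        _ ≤ ENNReal.ofReal (κ (t + 1)) * ENNReal.ofReal (e t * (1 / s)) := by gcongr
        _ = ENNReal.ofReal (κ (t + 1) * e t * (1 / s)) := by
          rw [← ENNReal.ofReal_mul (by linarith [hκ t]), mul_assoc]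
        _ ≤ _ := by
          refine ENNReal.ofReal_le_ofReal ?_
          have := he t
          gcongr
  have hset : A 0 \ A (t + 1) = {ω | Ψ 0 ω ≤ 1 - s} \ stayBelow Ψ ε (t + 1) := by
    rw [hA0, hA]; simp
  rw [← hset]
  have h2 : ENNReal.ofReal (1 / ε) * P (A 0 \ A (t + 1)) ≤ ENNReal.ofReal (e t * (1 / s)) :=
    le_add_self.trans (key t)
  calc P (A 0 \ A (t + 1)) = ENNReal.ofReal ε * (ENNReal.ofReal (1 / ε) * P (A 0 \ A (t + 1))) := by
        rw [← mul_assoc, ← ENNReal.ofReal_mul hε.le, mul_one_div_cancel hε.ne', ENNReal.ofReal_one,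
          one_mul]
    _ ≤ ENNReal.ofReal ε * ENNReal.ofReal (e t * (1 / s)) := by gcongr
    _ = _ := by rw [← ENNReal.ofReal_mul hε.le]; congr 1; ring

/-- Integrating out an independent variable. -/
lemma setLIntegral_le_of_indepFun [IsProbabilityMeasure P] {α β : Type*} [MeasurableSpace α]
    [MeasurableSpace β] {X : Ω → α} {Z : Ω → β} (hX : Measurable X) (hZ : Measurable Z)
    (hXZ : IndepFun X Z P) {F : α × β → ENNReal} (hF : Measurable F) {R : α → ENNReal}
    (hR : Measurable R) {A : Set α} (hA : MeasurableSet A)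
    (h : ∀ y ∈ A, ∫⁻ z, F (y, z) ∂(P.map Z) ≤ R y) :
    ∫⁻ ω in X ⁻¹' A, F (X ω, Z ω) ∂P ≤ ∫⁻ ω in X ⁻¹' A, R (X ω) ∂P := by
  have := Measure.isProbabilityMeasure_map (μ := P) hX.aemeasurable
  have := Measure.isProbabilityMeasure_map (μ := P) hZ.aemeasurable
  have hlaw := (indepFun_iff_map_prod_eq_prod_map_map hX.aemeasurable hZ.aemeasurable).1 hXZ
  have e1 : ∫⁻ ω in X ⁻¹' A, F (X ω, Z ω) ∂P =
      ∫⁻ y in A, ∫⁻ z, F (y, z) ∂(P.map Z) ∂(P.map X) := by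
    have hm : MeasurableSet (Prod.fst ⁻¹' A : Set (α × β)) := measurable_fst hA
    have e2 : ∫⁻ ω in X ⁻¹' A, F (X ω, Z ω) ∂P =
        ∫⁻ p in Prod.fst ⁻¹' A, F p ∂(P.map fun ω => (X ω, Z ω)) := by
      rw [setLIntegral_map hm hF (hX.prodMk hZ)]
      rfl
    rw [e2, hlaw, ← lintegral_indicator hm, lintegral_prod _ (hF.indicator hm).aemeasurable,
      ← lintegral_indicator hA]
    refine lintegral_congr fun y => ?_
    by_cases hy : y ∈ A
    · simp [Set.indicator, hy]
    · simp [Set.indicator, hy]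
  rw [e1, ← setLIntegral_map hA hR hX]
  exact setLIntegral_mono hR h

end Maximal

/-! ### Regrouping independent variables -/

section Independence

variable {Ω : Type*} [MeasurableSpace Ω] {P : Measure Ω}

/-- The triple has the product law in either bracketing. This joins the initial vector to the past
data, jointly independent of the next block. -/
lemma IndepFun.prodMk_left_of_indepFun [IsProbabilityMeasure P] {α β γ : Type*} [MeasurableSpace α]
    [MeasurableSpace β] [MeasurableSpace γ] {U : Ω → α} {V : Ω → β} {W : Ω → γ}
    (hU : Measurable U) (hV : Measurable V) (hW : Measurable W)
    (h1 : IndepFun U (fun ω => (V ω, W ω)) P) (h2 : IndepFun V W P) :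
    IndepFun (fun ω => (U ω, V ω)) W P := by
  have := Measure.isProbabilityMeasure_map (μ := P) hU.aemeasurable
  have := Measure.isProbabilityMeasure_map (μ := P) hV.aemeasurable
  have := Measure.isProbabilityMeasure_map (μ := P) hW.aemeasurable
  have h3 : IndepFun U V P := h1.comp measurable_id measurable_fst
  rw [indepFun_iff_map_prod_eq_prod_map_map (hU.prodMk hV).aemeasurable hW.aemeasurable,
    (indepFun_iff_map_prod_eq_prod_map_map hU.aemeasurable hV.aemeasurable).1 h3]
  have e1 := (indepFun_iff_map_prod_eq_prod_map_map hU.aemeasurable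
    (hV.prodMk hW).aemeasurable).1 h1
  rw [(indepFun_iff_map_prod_eq_prod_map_map hV.aemeasurable hW.aemeasurable).1 h2] at e1
  have e2 : P.map (fun ω => ((U ω, V ω), W ω)) =
      (P.map fun ω => (U ω, (V ω, W ω))).map MeasurableEquiv.prodAssoc.symm := by
    rw [Measure.map_map (MeasurableEquiv.measurable _) (hU.prodMk (hV.prodMk hW))]
    rfl
  rw [e2, e1]
  exact ((measurePreserving_prodAssoc (P.map U) (P.map V) (P.map W)).symm).map_eq

end Independence

/-! ### The iterates as a process driven by fresh blocks -/

section Stream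

variable {d N b : ℕ}

/-- The mini-batch of iteration `t + 1`. -/
def block (N b : ℕ) (x : ℕ → Vec d) (t : ℕ) : Fin N × Fin b → Vec d :=
  fun p => x ((p.2 : ℕ) + (p.1 : ℕ) * b + t * (N * b))

lemma iterate_succ (γ : ℕ → ℝ) (v : Vec d) (x : ℕ → Vec d) (t : ℕ) :
    iterate N b γ v x (t + 1) = step (γ (t + 1)) (block N b x t) (iterate N b γ v x t) := rfl

lemma block_index_lt (p : Fin N × Fin b) (t : ℕ) :
    (p.2 : ℕ) + (p.1 : ℕ) * b + t * (N * b) < (t + 1) * (N * b) := by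
  have h1 := p.1.2
  have h2 := p.2.2
  have h3 : ((p.1 : ℕ) + 1) * b ≤ N * b := Nat.mul_le_mul_right b h1
  nlinarith

/-- Uniqueness of quotient and remainder modulo `b`; hence the entries of a block are distinct
samples, and so independent. -/
lemma block_index_injective (t : ℕ) :
    Function.Injective fun p : Fin N × Fin b => (p.2 : ℕ) + (p.1 : ℕ) * b + t * (N * b) := by
  rintro ⟨i, j⟩ ⟨i', j'⟩ h
  simp only at h
  have hj := j.2
  have hj' := j'.2
  have hb : 0 < b := by omega
  have h1 : (j : ℕ) + (i : ℕ) * b = (j' : ℕ) + (i' : ℕ) * b := by omega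
  have h2 := congrArg (· / b) h1
  have h3 := congrArg (· % b) h1
  simp only [Nat.add_mul_div_right _ _ hb, Nat.div_eq_of_lt hj, Nat.div_eq_of_lt hj', zero_add] at h2
  simp only [Nat.add_mul_mod_self_right, Nat.mod_eq_of_lt hj, Nat.mod_eq_of_lt hj'] at h3
  exact Prod.ext (Fin.ext h2) (Fin.ext h3)

lemma iterate_congr (γ : ℕ → ℝ) (v : Vec d) {x y : ℕ → Vec d} {t : ℕ}
    (h : ∀ k < t * (N * b), x k = y k) : iterate N b γ v x t = iterate N b γ v y t := by
  induction t with
  | zero => rfl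
  | succ t ih =>
    rw [iterate_succ, iterate_succ, ih fun k hk => h k (hk.trans_le (Nat.mul_le_mul_right _ t.le_succ))]
    congr 1
    funext p
    exact h _ (block_index_lt p t)

lemma measurable_potential (q : Vec d) : Measurable (potential q) := by
  unfold potential
  fun_prop

lemma measurable_step (γ : ℝ) :
    Measurable fun p : Vec d × (Fin N × Fin b → Vec d) => step γ p.2 p.1 := by
  unfold step localUpdate
  fun_prop

lemma measurable_block (t : ℕ) : Measurable fun x : ℕ → Vec d => block N b x t :=
  measurable_pi_lambda _ fun _ => measurable_pi_apply _

lemma measurable_iterate (γ : ℕ → ℝ) (t : ℕ) :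
    Measurable fun p : Vec d × (ℕ → Vec d) => iterate N b γ p.1 p.2 t := by
  induction t with
  | zero => exact measurable_fst
  | succ t ih =>
    simp only [iterate_succ]
    exact (measurable_step (γ (t + 1))).comp (ih.prodMk ((measurable_block t).comp measurable_snd))

/-- Extension of a finite stretch of data by zero. -/
def extend (m : ℕ) (f : Finset.range m → Vec d) : ℕ → Vec d :=
  fun k => if h : k ∈ Finset.range m then f ⟨k, h⟩ else 0

lemma measurable_extend (m : ℕ) : Measurable (extend (d := d) m) := by
  refine measurable_pi_lambda _ fun k => ?_
  unfold extend
  by_cases h : k ∈ Finset.range m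
  · simp only [h, dite_true]
    exact measurable_pi_apply _
  · simp only [h, dite_false]
    exact measurable_const

lemma iterate_extend (γ : ℕ → ℝ) (v : Vec d) (x : ℕ → Vec d) {l t : ℕ} (hl : l ≤ t) :
    iterate N b γ v (extend (t * (N * b)) fun k => x k) l = iterate N b γ v x l := by
  refine iterate_congr γ v fun k hk => ?_
  have : k ∈ Finset.range (t * (N * b)) :=
    Finset.mem_range.2 (hk.trans_le (Nat.mul_le_mul_right _ hl))
  simp only [extend, this, dite_true]

variable {μ : Measure (Vec d)} {Ω : Type*} [MeasurableSpace Ω] {P : Measure Ω}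
  [IsProbabilityMeasure P] {v₀ : Ω → Vec d} {x : ℕ → Ω → Vec d}

lemma map_block_eq_pi [IsProbabilityMeasure μ] (hx : ∀ k, Measurable (x k))
    (hxlaw : ∀ k, P.map (x k) = μ)
    (hxindep : iIndepFun x P) (t : ℕ) :
    P.map (fun ω => block N b (fun k => x k ω) t) = Measure.pi fun _ => μ := by
  have h := hxindep.precomp (block_index_injective (N := N) (b := b) t)
  rw [iIndepFun_iff_map_fun_eq_pi_map fun p => (hx _).aemeasurable] at h
  simp only [hxlaw] at h
  exact h

/-- The samples before iteration `t + 1` and those of its block have disjoint index sets. -/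
lemma indepFun_history_block (hv₀ : Measurable v₀) (hx : ∀ k, Measurable (x k))
    (hxindep : iIndepFun x P) (hv₀indep : IndepFun v₀ (fun ω k => x k ω) P) (t : ℕ) :
    IndepFun (fun ω => (v₀ ω, fun k : Finset.range (t * (N * b)) => x k ω))
      (fun ω => block N b (fun k => x k ω) t) P := by
  classical
  set S := Finset.range (t * (N * b))
  set T := Finset.univ.image fun p : Fin N × Fin b => (p.2 : ℕ) + (p.1 : ℕ) * b + t * (N * b)
    with hT
  have hmemT : ∀ p : Fin N × Fin b, (p.2 : ℕ) + (p.1 : ℕ) * b + t * (N * b) ∈ T := fun p =>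
    Finset.mem_image_of_mem _ (Finset.mem_univ p)
  have hST : Disjoint S T := by
    rw [Finset.disjoint_left]
    intro k hk hk'
    obtain ⟨p, -, rfl⟩ := Finset.mem_image.1 hk'
    have := Finset.mem_range.1 hk
    omega
  have h1 := hxindep.indepFun_finset S T hST hx
  have hg : Measurable fun f : T → Vec d => fun p : Fin N × Fin b => f ⟨_, hmemT p⟩ :=
    measurable_pi_lambda _ fun _ => measurable_pi_apply _
  have h2 := h1.comp measurable_id hg
  have hxm : Measurable fun ω => fun k => x k ω := measurable_pi_lambda _ hx
  refine IndepFun.prodMk_left_of_indepFun hv₀ (measurable_pi_lambda _ fun k => hx k)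
    ((measurable_block t).comp hxm) ?_ h2
  exact hv₀indep.comp measurable_id
    ((measurable_pi_lambda (fun (f : ℕ → Vec d) (k : S) => f k)
      fun k => measurable_pi_apply _).prodMk (measurable_block t))

/-- The one-step recursion for the mean odds on an event determined by the past. -/
lemma SpectralGap.setLIntegral_odds_le [IsProbabilityMeasure μ] {r lam₁ lam₂ : ℝ} {q : Vec d}
    (h : SpectralGap μ lam₁ lam₂ q)
    (hb : ∀ᵐ x ∂μ, ‖x‖ ≤ r) (hN : 1 ≤ N) (hb1 : 1 ≤ b) (hv₀ : Measurable v₀)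
    (hx : ∀ k, Measurable (x k)) (hxlaw : ∀ k, P.map (x k) = μ)
    (hxindep : iIndepFun x P) (hv₀indep : IndepFun v₀ (fun ω k => x k ω) P)
    {γ : ℕ → ℝ} {Ψ : ℕ → Ω → ℝ}
    (hΨ : ∀ t ω, Ψ t ω = potential q (iterate N b γ (v₀ ω) (fun k => x k ω) t))
    {ε : ℝ} (hε : 0 < ε) (hε1 : ε ≤ 1) {t : ℕ}
    (hγ : 0 ≤ γ (t + 1)) (hγε : γ (t + 1) * r ^ 2 ≤ √ε / 4)
    (hα : 0 ≤ 1 - 2 * γ (t + 1) * (lam₁ - lam₂) +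
      16 * γ (t + 1) ^ 2 * (lam₁ ^ 2 + sigmaBSq μ N b / ε)) {s : ℝ} :
    ∫⁻ ω in {ω | Ψ 0 ω ≤ 1 - s} ∩ stayBelow Ψ ε (t + 1), odds (Ψ (t + 1) ω) ∂P ≤
      ENNReal.ofReal (1 - 2 * γ (t + 1) * (lam₁ - lam₂) +
        16 * γ (t + 1) ^ 2 * (lam₁ ^ 2 + sigmaBSq μ N b / ε)) *
        ∫⁻ ω in {ω | Ψ 0 ω ≤ 1 - s} ∩ stayBelow Ψ ε (t + 1), odds (Ψ t ω) ∂P +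
      ENNReal.ofReal (4 * γ (t + 1) ^ 2 * sigmaBSq μ N b) *
        P ({ω | Ψ 0 ω ≤ 1 - s} ∩ stayBelow Ψ ε (t + 1)) := by
  set α := 1 - 2 * γ (t + 1) * (lam₁ - lam₂) +
      16 * γ (t + 1) ^ 2 * (lam₁ ^ 2 + sigmaBSq μ N b / ε)
  set β := 4 * γ (t + 1) ^ 2 * sigmaBSq μ N b
  set m := t * (N * b)
  let X : Ω → Vec d × (Finset.range m → Vec d) := fun ω => (v₀ ω, fun k => x k ω)
  let Z : Ω → Fin N × Fin b → Vec d := fun ω => block N b (fun k => x k ω) t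
  have hxm : Measurable fun ω => fun k => x k ω := measurable_pi_lambda _ hx
  have hX : Measurable X := hv₀.prodMk (measurable_pi_lambda _ fun k => hx k)
  have hZ : Measurable Z := (measurable_block t).comp hxm
  -- Iterates up to time `t` depend only on the first `m` samples, so padding with zeros writes
  -- them, and the event `A`, as functions of the history `X`.
  let it : ℕ → Vec d × (Finset.range m → Vec d) → Vec d :=
    fun l y => iterate N b γ y.1 (extend m y.2) l
  have hit : ∀ l, Measurable (it l) := fun l => (measurable_iterate γ l).comp
    (measurable_fst.prodMk ((measurable_extend m).comp measurable_snd))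
  have hitX : ∀ l ≤ t, ∀ ω, potential q (it l (X ω)) = Ψ l ω := by
    intro l hl ω
    rw [hΨ]
    congr 1
    exact iterate_extend γ (v₀ ω) (fun k => x k ω) hl
  let A : Set (Vec d × (Finset.range m → Vec d)) :=
    {y | potential q (it 0 y) ≤ 1 - s} ∩ stayBelow (fun l y => potential q (it l y)) ε (t + 1)
  have hpm := measurable_potential q
  have hA : MeasurableSet A :=
    (measurableSet_le (hpm.comp (hit 0)) measurable_const).inter
      (measurableSet_stayBelow (fun l => hpm.comp (hit l)) ε _)
  have hAX : {ω | Ψ 0 ω ≤ 1 - s} ∩ stayBelow Ψ ε (t + 1) = X ⁻¹' A := by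
    ext ω
    simp only [A, stayBelow, Set.mem_inter_iff, Set.mem_ofPred_eq, Set.mem_preimage]
    rw [hitX 0 (Nat.zero_le _)]
    refine and_congr_right fun _ => forall₂_congr fun l hl => ?_
    rw [hitX l (Nat.lt_succ_iff.1 hl)]
  have hlaw : P.map Z = Measure.pi fun _ => μ := map_block_eq_pi hx hxlaw hxindep t
  have hind : IndepFun X Z P := indepFun_history_block hv₀ hx hxindep hv₀indep t
  have hΨm : ∀ l, Measurable (Ψ l) := by
    intro l
    have : Ψ l = fun ω => potential q (iterate N b γ (v₀ ω) (fun k => x k ω) l) :=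
      funext fun ω => hΨ l ω
    rw [this]
    exact hpm.comp ((measurable_iterate γ l).comp (hv₀.prodMk hxm))
  have hpt : ∀ y ∈ A, ∫⁻ z, odds (potential q (step (γ (t + 1)) z (it t y))) ∂(P.map Z) ≤
      ENNReal.ofReal α * odds (potential q (it t y)) + ENNReal.ofReal β := by
    intro y hy
    have hy2 : potential q (it t y) ≤ 1 - ε := hy.2 t (Nat.lt_succ_self t)
    rw [hlaw]
    exact h.lintegral_odds_step_le hb hN hb1 hε hε1 hγ hγε hα hy2
  have hstepX : ∀ ω, Ψ (t + 1) ω = potential q (step (γ (t + 1)) (Z ω) (it t (X ω))) := by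
    intro ω
    have h1 : it t (X ω) = iterate N b γ (v₀ ω) (fun k => x k ω) t :=
      iterate_extend γ (v₀ ω) (fun k => x k ω) le_rfl
    rw [hΨ, iterate_succ, h1]
  clear_value it A X Z
  have hF : Measurable fun p : (Vec d × (Finset.range m → Vec d)) × (Fin N × Fin b → Vec d) =>
      odds (potential q (step (γ (t + 1)) p.2 (it t p.1))) := by
    have h1 : Measurable fun p : (Vec d × (Finset.range m → Vec d)) × (Fin N × Fin b → Vec d) =>
        (it t p.1, p.2) := ((hit t).comp measurable_fst).prodMk measurable_snd
    exact measurable_odds.comp (hpm.comp ((measurable_step (γ (t + 1))).comp h1))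
  have hR : Measurable fun y => ENNReal.ofReal α * odds (potential q (it t y)) +
      ENNReal.ofReal β := ((measurable_odds.comp (hpm.comp (hit t))).const_mul _).add_const _
  have hmain := setLIntegral_le_of_indepFun hX hZ hind hF hR hA hpt
  have hO : Measurable fun ω => odds (Ψ t ω) := measurable_odds.comp (hΨm t)
  rw [hAX]
  calc _ = ∫⁻ ω in X ⁻¹' A, odds (potential q (step (γ (t + 1)) (Z ω) (it t (X ω)))) ∂P := by
        refine lintegral_congr fun ω => ?_
        rw [hstepX]
    _ ≤ ∫⁻ ω in X ⁻¹' A, (ENNReal.ofReal α * odds (potential q (it t (X ω))) +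
          ENNReal.ofReal β) ∂P := hmain
    _ = ∫⁻ ω in X ⁻¹' A, (ENNReal.ofReal α * odds (Ψ t ω) + ENNReal.ofReal β) ∂P := by
        simp only [hitX t le_rfl]
    _ = _ := by
        rw [lintegral_add_right _ measurable_const, lintegral_const_mul _ hO,
          setLIntegral_const]

end Stream

/-! ### Constants, and explicit solutions of the scalar recursion -/

section Numerics

lemma one_le_log_four_div {δ : ℝ} (hδ₀ : 0 < δ) (hδ₁ : δ < 1) : 1 ≤ Real.log (4 / δ) := by
  rw [Real.le_log_iff_exp_le (by positivity), le_div_iff₀ hδ₀]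
  have := Real.exp_one_lt_d9
  nlinarith [Real.exp_pos 1]

lemma two_le_exp_one : 2 ≤ Real.exp 1 := by linarith [Real.exp_one_gt_d9]

lemma le_L1 {d : ℕ} {r c δ : ℝ} (hδ₀ : 0 < δ) (hδ₁ : δ < 1) :
    128 * d * r ^ 4 * max 1 (c ^ 2) / δ ^ 2 ≤ L1 d r c δ := by
  have h1 := one_le_log_four_div hδ₀ hδ₁
  have h2 := two_le_exp_one
  have h3 : 0 ≤ max 1 (c ^ 2) := le_trans zero_le_one (le_max_left _ _)
  have hr4 : 0 ≤ r ^ 4 := by positivity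
  calc _ = 64 * 2 * d * r ^ 4 * max 1 (c ^ 2) / δ ^ 2 * 1 := by ring
    _ ≤ _ := by unfold L1; gcongr

lemma le_L2_div {d : ℕ} {σ c δ : ℝ} (hσ : 0 < σ) (hδ₀ : 0 < δ) (hδ₁ : δ < 1) :
    2048 * d ^ 2 * max 1 (c ^ 2) / δ ^ 4 ≤ L2 d σ c δ / σ := by
  have h1 := one_le_log_four_div hδ₀ hδ₁
  have h2 := two_le_exp_one
  have h3 : 0 ≤ max 1 (c ^ 2) := le_trans zero_le_one (le_max_left _ _)
  calc _ = 512 * 2 ^ 2 * d ^ 2 * max 1 (c ^ 2) / δ ^ 4 * 1 := by ring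
    _ ≤ 512 * Real.exp 1 ^ 2 * d ^ 2 * max 1 (c ^ 2) / δ ^ 4 * Real.log (4 / δ) := by gcongr
    _ = _ := by unfold L2; field_simp

lemma L2_div_nonneg {d : ℕ} {σ c δ : ℝ} (hσ : 0 ≤ σ) (hδ₀ : 0 < δ) (hδ₁ : δ < 1) :
    0 ≤ L2 d σ c δ / σ := by
  have h1 := one_le_log_four_div hδ₀ hδ₁
  have h3 : 0 ≤ max 1 (c ^ 2) := le_trans zero_le_one (le_max_left _ _)
  have h4 : 0 ≤ Real.log (4 / δ) := by linarith
  unfold L2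
  positivity

/-- The step size offset dominates the accumulated noise and the drift. -/
lemma offset_bounds {d : ℕ} (hd : 2 ≤ d) {r c δ σ lam L₁' L₂' L : ℝ} (hr : 1 ≤ r) (hc : 0 < c)
    (hδ₀ : 0 < δ) (hδ₁ : δ < 1) (hσ : 0 ≤ σ) (hlam0 : 0 ≤ lam) (hlam : lam ≤ r ^ 2)
    (hL₁' : L1 d r c δ ≤ L₁') (hL₂' : L2 d σ c δ / σ ≤ L₂') (hL : L = L₁' + σ * L₂') :
    1 ≤ L ∧ 16 * c ^ 2 * (lam ^ 2 + σ / (δ ^ 3 / (16 * d))) ≤ L / 8 ∧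
      16 * (2 * c * r ^ 2) ≤ L ∧ c * r ^ 2 / L ≤ √(δ ^ 3 / (16 * d)) / 4 ∧ L₁' ≤ L ∧ 0 < L₁' ∧
      0 ≤ L₂' := by
  have hd' : (2 : ℝ) ≤ d := by exact_mod_cast hd
  have hL2nn : 0 ≤ L₂' := (L2_div_nonneg hσ hδ₀ hδ₁).trans hL₂'
  have hLL1 : L₁' ≤ L := by rw [hL]; nlinarith
  have hM1 : 1 ≤ max 1 (c ^ 2) := le_max_left _ _
  have hMc : c ^ 2 ≤ max 1 (c ^ 2) := le_max_right _ _
  set M := max 1 (c ^ 2)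
  -- Here `2 c ≤ 1 + c ^ 2 ≤ 2 M`.
  have hMcc : c ≤ M := by nlinarith [sq_nonneg (c - 1)]
  have hr2 : 1 ≤ r ^ 2 := by nlinarith
  have hr4 : r ^ 2 ≤ r ^ 4 := by nlinarith [sq_nonneg (r ^ 2)]
  have hδ2 : δ ^ 2 ≤ 1 := by nlinarith
  have hbase : 128 * d * r ^ 4 * M / δ ^ 2 ≤ L := (le_L1 hδ₀ hδ₁).trans (hL₁'.trans hLL1)
  have hA : ∀ y, 0 ≤ y → y ≤ M → 128 * d * r ^ 4 * y / δ ^ 2 ≤ L := by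
    intro y hy hyM
    refine le_trans ?_ hbase
    gcongr
  have hA' : ∀ y, 0 ≤ y → y ≤ M → 256 * r ^ 4 * y ≤ L := by
    intro y hy hyM
    refine le_trans ?_ (hA y hy hyM)
    rw [le_div_iff₀ (by positivity)]
    have : 0 ≤ r ^ 4 * y := by positivity
    nlinarith [mul_le_mul_of_nonneg_left hδ2 this]
  have h1 := hA' 1 zero_le_one hM1
  have hLpos : 0 < L := by nlinarith
  refine ⟨by nlinarith, ?_, ?_, ?_, hLL1, ?_, hL2nn⟩
  · have e1 := hA' (c ^ 2) (sq_nonneg c) hMc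
    have e2 : lam ^ 2 ≤ r ^ 4 := by
      calc lam ^ 2 ≤ (r ^ 2) ^ 2 := by gcongr
        _ = _ := by ring
    have e3 : 16 * c ^ 2 * lam ^ 2 ≤ L / 16 := by
      have : c ^ 2 * lam ^ 2 ≤ c ^ 2 * r ^ 4 := by gcongr
      nlinarith
    have e4 : 16 * c ^ 2 * (σ / (δ ^ 3 / (16 * d))) ≤ L / 16 := by
      -- Without noise the quotient `L2 / σ` is `0` by convention and gives no information, but then
      -- none is needed.
      rcases hσ.eq_or_lt with h0 | h0
      · rw [← h0]; simp; positivity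
      · have e5 : σ * (2048 * d ^ 2 * c ^ 2 / δ ^ 4) ≤ L := by
          have e6 := (le_L2_div (d := d) (c := c) h0 hδ₀ hδ₁).trans hL₂'
          have e7 : 2048 * d ^ 2 * c ^ 2 / δ ^ 4 ≤ L₂' := by
            refine le_trans ?_ e6
            gcongr
          have e8 : 0 < L₁' := by
            refine lt_of_lt_of_le ?_ ((le_L1 hδ₀ hδ₁).trans hL₁')
            positivity
          rw [hL]
          nlinarith [mul_le_mul_of_nonneg_left e7 hσ]
        refine le_trans ?_ (div_le_div_of_nonneg_right e5 (by norm_num))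
        have e9 : 16 * c ^ 2 * (σ / (δ ^ 3 / (16 * d))) =
            σ * (2048 * d ^ 2 * c ^ 2 / δ ^ 4) / 16 * (2 * δ / d) := by
          field_simp
          ring
        rw [e9]
        refine mul_le_of_le_one_right (by positivity) ?_
        rw [div_le_one (by positivity)]
        linarith
    rw [mul_add]
    linarith
  · have := hA' c hc.le hMcc
    nlinarith [mul_le_mul_of_nonneg_left hr4 hc.le]
  · have e1 := hA (c ^ 2) (sq_nonneg c) hMc
    have e2 := hA 1 zero_le_one hM1
    rw [div_le_iff₀ hLpos]
    refine (sq_le_sq₀ (by positivity) (by positivity)).1 ?_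
    rw [mul_pow, mul_pow, div_pow, Real.sq_sqrt (by positivity)]
    -- The maximum in `L1` is bounded below once by `c ^ 2` and once by `1`, to match the single
    -- factor `c ^ 2` on the left.
    have e3 : (128 * d * r ^ 4 * c ^ 2 / δ ^ 2) * (128 * d * r ^ 4 * 1 / δ ^ 2) ≤ L * L :=
      mul_le_mul e1 e2 (by positivity) hLpos.le
    calc c ^ 2 * (r ^ 2) ^ 2 ≤ c ^ 2 * r ^ 4 * (r ^ 4 * (64 * d / δ)) := by
          have : 1 ≤ r ^ 4 * (64 * d / δ) := by
            have : 1 ≤ 64 * d / δ := by rw [le_div_iff₀ hδ₀]; linarith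
            nlinarith
          have h5 : 0 ≤ c ^ 2 * r ^ 4 := by positivity
          nlinarith
      _ = δ ^ 3 / (16 * d) / 4 ^ 2 * ((128 * d * r ^ 4 * c ^ 2 / δ ^ 2) * (128 * d * r ^ 4 * 1 / δ ^ 2)) := by
          field_simp
          ring
      _ ≤ δ ^ 3 / (16 * d) / 4 ^ 2 * (L * L) := by gcongr
      _ = _ := by ring
  · refine lt_of_lt_of_le ?_ ((le_L1 hδ₀ hδ₁).trans hL₁')
    positivity

variable {L κ c₀ : ℝ}

lemma inv_sq_le_sub {n : ℝ} (hn : 1 < n) : 1 / n ^ 2 ≤ 1 / (n - 1) - 1 / n := by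
  have h1 : 0 < n - 1 := by linarith
  have h2 : 0 < n := by linarith
  rw [div_sub_div _ _ h1.ne' h2.ne', div_le_div_iff₀ (by positivity) (by positivity)]
  nlinarith

/-- Bounds the product of the factors `1 + κ / (L + k) ^ 2`. -/
noncomputable def growth (L κ : ℝ) (t : ℕ) : ℝ := Real.exp (κ * (1 / L - 1 / (L + t)))

lemma growth_pos (L κ : ℝ) (t : ℕ) : 0 < growth L κ t := Real.exp_pos _

lemma growth_zero (L κ : ℝ) : growth L κ 0 = 1 := by simp [growth]

lemma growth_le (hL : 0 < L) (hκ : 0 ≤ κ) (t : ℕ) : growth L κ t ≤ Real.exp (κ / L) := by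
  unfold growth
  refine Real.exp_le_exp.2 ?_
  have : 0 ≤ 1 / (L + t) := by positivity
  rw [div_eq_mul_one_div κ]
  exact mul_le_mul_of_nonneg_left (by linarith) hκ

/-- The exponents telescope, because `1 / n ^ 2 ≤ 1 / (n - 1) - 1 / n`. -/
lemma exp_mul_growth_le (hL : 1 ≤ L) (hκ : 0 ≤ κ) (t : ℕ) :
    Real.exp (κ / (L + (t + 1 : ℕ)) ^ 2) * growth L κ t ≤ growth L κ (t + 1) := by
  unfold growth
  rw [← Real.exp_add]
  refine Real.exp_le_exp.2 ?_
  have h0 : (0 : ℝ) ≤ t := Nat.cast_nonneg t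
  have h1 := inv_sq_le_sub (n := L + (t + 1 : ℕ)) (by push_cast; linarith)
  have h2 : L + ((t + 1 : ℕ) : ℝ) - 1 = L + t := by push_cast; ring
  rw [h2] at h1
  have h3 := mul_le_mul_of_nonneg_left h1 hκ
  have h4 : κ / (L + (t + 1 : ℕ)) ^ 2 = κ * (1 / (L + (t + 1 : ℕ)) ^ 2) := by ring
  rw [h4]
  linarith

lemma one_add_mul_growth_le (hL : 1 ≤ L) (hκ : 0 ≤ κ) (t : ℕ) :
    (1 + κ / (L + (t + 1 : ℕ)) ^ 2) * growth L κ t ≤ growth L κ (t + 1) := by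
  refine le_trans ?_ (exp_mul_growth_le hL hκ t)
  refine mul_le_mul_of_nonneg_right ?_ (growth_pos L κ t).le
  linarith [Real.add_one_le_exp (κ / (L + (t + 1 : ℕ)) ^ 2)]

/-- Bounds the product of the factors `1 - c₀ / (L + k) + κ / (L + k) ^ 2`. -/
noncomputable def decay (L κ c₀ : ℝ) (t : ℕ) : ℝ :=
  growth L κ t * ((L + 1) / (L + t + 1)) ^ c₀

lemma decay_zero (hL : 1 ≤ L) : decay L κ c₀ 0 = 1 := by
  rw [decay, growth_zero, Nat.cast_zero, add_zero, div_self (by linarith), Real.one_rpow, one_mul]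

lemma decay_nonneg (hL : 1 ≤ L) (t : ℕ) : 0 ≤ decay L κ c₀ t := by
  have := growth_pos L κ t
  unfold decay
  positivity

/-- The factor is at most `exp (κ / n ^ 2) * exp (-c₀ / n)`, and `(n + 1) / n ≤ exp (1 / n)` bounds
the second exponential by `(n / (n + 1)) ^ c₀`. This is why `decay` has its base shifted by one. -/
lemma mul_decay_le (hL : 1 ≤ L) (hκ : 0 ≤ κ) (hc₀ : 0 ≤ c₀) (t : ℕ) :
    (1 - c₀ / (L + (t + 1 : ℕ)) + κ / (L + (t + 1 : ℕ)) ^ 2) * decay L κ c₀ t ≤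
      decay L κ c₀ (t + 1) := by
  have h0 : (0 : ℝ) ≤ t := Nat.cast_nonneg t
  set n : ℝ := L + (t + 1 : ℕ) with hn
  have hn' : L + t + 1 = n := by rw [hn]; push_cast; ring
  have hnpos : 0 < n := by linarith
  have h1 : 1 - c₀ / n + κ / n ^ 2 ≤ Real.exp (κ / n ^ 2) * (n / (n + 1)) ^ c₀ := by
    have e1 := Real.add_one_le_exp (-(c₀ / n) + κ / n ^ 2)
    have e2 : Real.exp (-(c₀ / n)) ≤ (n / (n + 1)) ^ c₀ := by
      have e3 : (n + 1) / n ≤ Real.exp (1 / n) := by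
        have := Real.add_one_le_exp (1 / n)
        have e4 : (n + 1) / n = 1 / n + 1 := by field_simp; ring
        linarith
      have e5 : ((n + 1) / n) ^ c₀ ≤ Real.exp (c₀ / n) := by
        calc _ ≤ (Real.exp (1 / n)) ^ c₀ := by gcongr
          _ = _ := by rw [← Real.exp_mul]; congr 1; ring
      have e6 : n / (n + 1) = ((n + 1) / n)⁻¹ := by rw [inv_div]
      rw [Real.exp_neg, e6, Real.inv_rpow (by positivity)]
      exact inv_anti₀ (by positivity) e5
    rw [Real.exp_add] at e1
    nlinarith [Real.exp_pos (κ / n ^ 2)]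
  have h2 : decay L κ c₀ (t + 1) = growth L κ (t + 1) * (((L + 1) / n) ^ c₀ * (n / (n + 1)) ^ c₀) := by
    rw [← Real.mul_rpow (by positivity) (by positivity), decay]
    congr 2
    rw [← hn]
    field_simp
  rw [h2, decay, hn']
  calc _ ≤ Real.exp (κ / n ^ 2) * (n / (n + 1)) ^ c₀ * (growth L κ t * ((L + 1) / n) ^ c₀) := by
        have := growth_pos L κ t
        gcongr
    _ = Real.exp (κ / n ^ 2) * growth L κ t * (((L + 1) / n) ^ c₀ * (n / (n + 1)) ^ c₀) := by ring
    _ ≤ _ := by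
        refine mul_le_mul_of_nonneg_right (exp_mul_growth_le hL hκ t) ?_
        positivity

/-- After clearing denominators one needs `H κ + σ (n - 1) ≤ H (c₀ - 1) n`. As `κ ≤ n`, the `κ` term
costs one unit of `c₀`, and `H (c₀ - 2)` pays for the noise. The factor `2` in `H` is spare and
agrees with the `8` in `C2`. -/
lemma mul_harmonic_le {H σ : ℝ} (hL : 1 ≤ L) (hκL : κ ≤ L) (hc₀ : 2 < c₀) (hσ : 0 ≤ σ)
    (hH : H = 2 * σ / (c₀ - 2)) (t : ℕ) :
    (1 - c₀ / (L + (t + 1 : ℕ)) + κ / (L + (t + 1 : ℕ)) ^ 2) * (H / (L + t)) +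
      σ / (L + (t + 1 : ℕ)) ^ 2 ≤ H / (L + (t + 1 : ℕ)) := by
  have h0 : (0 : ℝ) ≤ t := Nat.cast_nonneg t
  set n : ℝ := L + (t + 1 : ℕ) with hn
  have hn' : L + t = n - 1 := by rw [hn]; push_cast; ring
  have hn1 : 0 < n - 1 := by linarith
  have hnpos : 0 < n := by linarith
  have hH0 : 0 ≤ H := by rw [hH]; exact div_nonneg (by linarith) (by linarith)
  have hH2 : H * (c₀ - 2) = 2 * σ := by rw [hH, div_mul_cancel₀ _ (by linarith)]
  rw [hn']
  have e1 : (1 - c₀ / n + κ / n ^ 2) * (H / (n - 1)) + σ / n ^ 2 =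
      (H * (n ^ 2 - c₀ * n + κ) + σ * (n - 1)) / (n ^ 2 * (n - 1)) := by
    field_simp
  rw [e1, div_le_div_iff₀ (by positivity) hnpos]
  have e2 : H * (n ^ 2 - c₀ * n + κ) + σ * (n - 1) ≤ H * n * (n - 1) := by
    have e3 : H * κ ≤ H * n := mul_le_mul_of_nonneg_left (by linarith) hH0
    have e4 : H * (c₀ - 2) * n = 2 * σ * n := by rw [hH2]
    nlinarith [mul_nonneg hσ hnpos.le]
  calc _ ≤ H * n * (n - 1) * n := by gcongr
    _ = _ := by ring

/-- Since `(L + τ) ^ 2 ≥ 2 L τ`, the power `c₀` of `L / (L + τ)` is traded for the power `c₀ / 2` of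
`L / (2 τ)`. The growth factor and the shift by one cost `exp (1 / 8)` each. -/
lemma decay_le (hL : 1 ≤ L) (hκ : 0 ≤ κ) (hκL : κ ≤ L / 8) (hc₀ : 2 < c₀) (hc₀L : c₀ ≤ L / 8)
    {τ : ℕ} (hτ : 1 ≤ τ) : decay L κ c₀ τ ≤ 2 * (L / τ / 2) ^ (c₀ / 2) := by
  have hLpos : 0 < L := by linarith
  have hτ' : (1 : ℝ) ≤ τ := by exact_mod_cast hτ
  have e1 : growth L κ τ ≤ Real.exp (1 / 8) := (growth_le hLpos hκ τ).trans
    (Real.exp_le_exp.2 (by rw [div_le_iff₀ hLpos]; linarith))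
  have e2 : ((L + 1) / (L + τ + 1)) ^ c₀ ≤ Real.exp (1 / 8) * (L / (L + τ)) ^ c₀ := by
    have e3 : (L + 1) / (L + τ + 1) ≤ Real.exp (1 / L) * (L / (L + τ)) := by
      have e4 := Real.add_one_le_exp (1 / L)
      have e5 : (L + 1) / (L + τ + 1) ≤ (1 / L + 1) * (L / (L + τ)) := by
        have : (1 / L + 1) * (L / (L + τ)) = (L + 1) / (L + τ) := by field_simp; ring
        rw [this]
        exact div_le_div_of_nonneg_left (by positivity) (by positivity) (by linarith)
      refine e5.trans ?_
      gcongr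
    calc _ ≤ (Real.exp (1 / L) * (L / (L + τ))) ^ c₀ := by gcongr
      _ = Real.exp (c₀ / L) * (L / (L + τ)) ^ c₀ := by
        rw [Real.mul_rpow (Real.exp_pos _).le (by positivity), ← Real.exp_mul]
        congr 2
        ring
      _ ≤ _ := by
        refine mul_le_mul_of_nonneg_right (Real.exp_le_exp.2 ?_) (by positivity)
        rw [div_le_iff₀ hLpos]
        linarith
  have e6 : (L / (L + τ)) ^ c₀ ≤ (L / τ / 2) ^ (c₀ / 2) := by
    have : (L / (L + τ)) ^ c₀ = ((L / (L + τ)) ^ 2) ^ (c₀ / 2) := by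
      rw [← Real.rpow_natCast, ← Real.rpow_mul (by positivity)]
      congr 1
      push_cast
      ring
    rw [this]
    refine Real.rpow_le_rpow (by positivity) ?_ (by linarith)
    rw [div_pow, div_div, div_le_div_iff₀ (by positivity) (by positivity)]
    have : L * (L * (↑τ * 2)) ≤ L * (L + ↑τ) ^ 2 := by
      refine mul_le_mul_of_nonneg_left ?_ hLpos.le
      nlinarith [sq_nonneg (τ : ℝ), sq_nonneg L]
    nlinarith
  have e7 : Real.exp (1 / 8) * Real.exp (1 / 8) ≤ 2 := by
    have h1 : Real.exp (1 / 8) ^ 8 = Real.exp 1 := by rw [← Real.exp_nat_mul]; norm_num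
    have h2 := Real.exp_one_lt_d9
    have h3 : (Real.exp (1 / 8) * Real.exp (1 / 8)) ^ 4 = Real.exp 1 := by rw [← h1]; ring
    by_contra h4
    have h5 : (2 : ℝ) ^ 4 ≤ (Real.exp (1 / 8) * Real.exp (1 / 8)) ^ 4 := by
      gcongr
      linarith
    rw [h3] at h5
    linarith
  calc decay L κ c₀ τ ≤ Real.exp (1 / 8) * (Real.exp (1 / 8) * (L / (L + τ)) ^ c₀) := by
        unfold decay
        gcongr
    _ = Real.exp (1 / 8) * Real.exp (1 / 8) * (L / (L + τ)) ^ c₀ := by ring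
    _ ≤ 2 * (L / τ / 2) ^ (c₀ / 2) := by gcongr

lemma midpoint_rpow_le {a b p : ℝ} (ha : 0 ≤ a) (hb : 0 ≤ b) (hp : 0 ≤ p) :
    ((a + b) / 2) ^ p ≤ a ^ p + b ^ p := by
  have ha' := Real.rpow_nonneg ha p
  have hb' := Real.rpow_nonneg hb p
  rcases le_total a b with h | h
  · calc _ ≤ b ^ p := Real.rpow_le_rpow (by positivity) (by linarith) hp
      _ ≤ _ := by linarith
  · calc _ ≤ a ^ p := Real.rpow_le_rpow (by positivity) (by linarith) hp
      _ ≤ _ := by linarith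

lemma le_mul_C1 {d : ℕ} (hd : 2 ≤ d) {δ c lam : ℝ} (hδ₀ : 0 < δ) (hδ₁ : δ < 1) (hL : 0 < L)
    (hc₀ : 2 < c₀) : 2 / (δ ^ 3 / (16 * d)) ≤ c₀ * C1 d δ c lam L := by
  have hd' : (2 : ℝ) ≤ d := by exact_mod_cast hd
  set X := 4 * Real.exp 1 * d / δ ^ 2 with hX
  have hX8 : 8 * d / δ ^ 2 ≤ X := by
    rw [hX]
    gcongr
    linarith [two_le_exp_one]
  have h8 : 1 ≤ 8 * d / δ ^ 2 := by
    rw [le_div_iff₀ (by positivity)]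
    nlinarith
  -- The cube is all that is used of the large power in `C1`.
  have hexp : 3 ≤ 5 / (2 * Real.log 2) := by
    have := Real.log_two_lt_d9
    have h2 := Real.log_pos one_lt_two
    rw [le_div_iff₀ (by positivity)]
    linarith
  have hpow : (8 * d / δ ^ 2) ^ 3 ≤ X ^ (5 / (2 * Real.log 2)) := by
    calc (8 * d / δ ^ 2) ^ 3 ≤ X ^ 3 := by gcongr
      _ = X ^ (3 : ℝ) := by rw [← Real.rpow_natCast]; norm_num
      _ ≤ _ := Real.rpow_le_rpow_of_exponent_le (h8.trans hX8) hexp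
  have he : 1 ≤ Real.exp (2 * c ^ 2 * lam ^ 2 / L) := Real.one_le_exp (by positivity)
  have hY : 0 ≤ X ^ (5 / (2 * Real.log 2)) := le_trans (by positivity) hpow
  calc 2 / (δ ^ 3 / (16 * d)) = 32 * d / δ ^ 3 := by field_simp; norm_num
    _ ≤ (8 * d / δ ^ 2) ^ 3 := by
      have : (8 * d / δ ^ 2) ^ 3 = 32 * d / δ ^ 3 * (16 * d ^ 2 / δ ^ 3) := by
        field_simp
        norm_num
      rw [this]
      refine le_mul_of_one_le_right (by positivity) ?_
      rw [le_div_iff₀ (by positivity)]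
      have : δ ^ 3 ≤ 1 := pow_le_one₀ hδ₀.le hδ₁.le
      nlinarith
    _ ≤ X ^ (5 / (2 * Real.log 2)) := hpow
    _ = 2 * (1 / 2 * X ^ (5 / (2 * Real.log 2)) * 1) := by ring
    _ ≤ c₀ * C1 d δ c lam L := by
      unfold C1
      rw [← hX]
      gcongr

/-- The bound of the recursion is at most the claimed error bound. -/
lemma bound_le_errorBound {d : ℕ} (hd : 2 ≤ d) {δ c lam L₁' L₂' σ s : ℝ} {τ B T : ℕ}
    (hδ₀ : 0 < δ) (hδ₁ : δ < 1) (hσ : 0 ≤ σ) (hL₁' : 0 < L₁') (hL₂' : 0 ≤ L₂')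
    (hLeq : L = L₁' + σ * L₂') (hL : 1 ≤ L) (hκ : 0 ≤ κ) (hκL : κ ≤ L / 8) (hc₀ : 2 < c₀)
    (hc₀L : c₀ ≤ L / 8) (hτ : 1 ≤ τ) (hB : 1 ≤ B) (hT : T = τ * B) (hs : σ * B = s)
    (hBT : (B : ℝ) ≤ (T : ℝ) ^ (1 - 2 / c₀)) :
    1 / (δ ^ 3 / (16 * d)) * decay L κ c₀ τ + 2 * (4 * c ^ 2 * σ) / (c₀ - 2) / (L + τ) ≤
      errorBound c₀ (C1 d δ c lam L) (C2 c₀ c lam L) L₁' L₂' s T := by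
  have hLpos : 0 < L := by linarith
  have hd' : (2 : ℝ) ≤ d := by exact_mod_cast hd
  have hτ' : (1 : ℝ) ≤ τ := by exact_mod_cast hτ
  have hB' : (1 : ℝ) ≤ B := by exact_mod_cast hB
  have hT' : (T : ℝ) = τ * B := by rw [hT]; push_cast; ring
  have hTpos : (0 : ℝ) < T := by rw [hT']; positivity
  have hp : 0 < c₀ / 2 := by linarith
  have h1 : (L / τ / 2) ^ (c₀ / 2) ≤ L₁' ^ (c₀ / 2) / T + (s * L₂' / T) ^ (c₀ / 2) := by
    -- With `τ = T / B` and `σ = s / B`, the batch size cancels in the noise part. The `1 / 2` is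
    -- spent in splitting the power of the sum.
    have e1 : L / τ / 2 = (L₁' * (B / T) + s * L₂' / T) / 2 := by
      rw [hLeq, ← hs, hT']
      field_simp
    have hsnn : 0 ≤ s := by rw [← hs]; positivity
    have e2 : (L₁' * (B / T)) ^ (c₀ / 2) ≤ L₁' ^ (c₀ / 2) / T := by
      rw [Real.mul_rpow hL₁'.le (by positivity), div_eq_mul_one_div (L₁' ^ (c₀ / 2))]
      refine mul_le_mul_of_nonneg_left ?_ (by positivity)
      -- The limit on the batch size is exactly what makes `(B / T) ^ (c₀ / 2) ≤ 1 / T`.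
      have e3 : (B : ℝ) / T ≤ (T : ℝ) ^ (-(2 / c₀)) := by
        rw [div_le_iff₀ hTpos]
        refine hBT.trans_eq ?_
        conv_rhs => rw [← Real.rpow_one (T : ℝ), ← Real.rpow_mul hTpos.le, one_mul,
          ← Real.rpow_add hTpos]
        congr 1
        ring
      calc ((B : ℝ) / T) ^ (c₀ / 2) ≤ ((T : ℝ) ^ (-(2 / c₀))) ^ (c₀ / 2) := by gcongr
        _ = 1 / T := by
          rw [← Real.rpow_mul hTpos.le]
          have : -(2 / c₀) * (c₀ / 2) = -1 := by field_simp
          rw [this, Real.rpow_neg_one, one_div]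
    rw [e1]
    refine (midpoint_rpow_le (by positivity) (by positivity) hp.le).trans ?_
    linarith
  have h2 : 1 / (δ ^ 3 / (16 * d)) * decay L κ c₀ τ ≤
      c₀ * C1 d δ c lam L * (L₁' ^ (c₀ / 2) / T + (s * L₂' / T) ^ (c₀ / 2)) := by
    calc _ ≤ 1 / (δ ^ 3 / (16 * d)) * (2 * (L / τ / 2) ^ (c₀ / 2)) := by
          gcongr
          exact decay_le hL hκ hκL hc₀ hc₀L hτ
      _ = 2 / (δ ^ 3 / (16 * d)) * (L / τ / 2) ^ (c₀ / 2) := by ring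
      _ ≤ _ := mul_le_mul (le_mul_C1 hd hδ₀ hδ₁ hLpos hc₀) h1 (by positivity)
          (le_trans (by positivity) (le_mul_C1 hd hδ₀ hδ₁ hLpos hc₀))
  have h3 : 2 * (4 * c ^ 2 * σ) / (c₀ - 2) / (L + τ) ≤ C2 c₀ c lam L * s / T := by
    have hc2 : 0 < c₀ - 2 := by linarith
    have he : 1 ≤ Real.exp ((c₀ + 2 * c ^ 2 * lam ^ 2) / L) :=
      Real.one_le_exp (by positivity)
    calc _ ≤ 2 * (4 * c ^ 2 * σ) / (c₀ - 2) / τ := by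
          gcongr
          linarith
      _ = 8 * c ^ 2 * 1 / (c₀ - 2) * s / T := by
          rw [← hs, hT']
          field_simp
          ring
      _ ≤ _ := by
          have hsnn : 0 ≤ s := by rw [← hs]; positivity
          unfold C2
          gcongr
  unfold errorBound
  linarith

/-- The error bound decays like `1 / T`, uniformly in the batch size. -/
lemma errorBound_le {d : ℕ} {δ c lam L₁' L₂' s : ℝ} {T : ℕ} (hδ₀ : 0 < δ)
    (hc₀ : 2 < c₀) (hL₁' : 0 < L₁') (hL₂' : 0 ≤ L₂') (hL : L₁' ≤ L) (hs : 0 ≤ s) (hT : 1 ≤ T) :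
    errorBound c₀ (C1 d δ c lam L) (C2 c₀ c lam L) L₁' L₂' s T ≤
      (c₀ * C1 d δ c lam L₁' * L₁' ^ (c₀ / 2) + c₀ * C1 d δ c lam L₁' * (s * L₂') ^ (c₀ / 2) +
        C2 c₀ c lam L₁' * s) / T := by
  have hT' : (1 : ℝ) ≤ T := by exact_mod_cast hT
  have hLpos : 0 < L := by linarith
  have hc2 : 0 < c₀ - 2 := by linarith
  have h1 : C1 d δ c lam L ≤ C1 d δ c lam L₁' := by
    unfold C1
    gcongr
  have h2 : C2 c₀ c lam L ≤ C2 c₀ c lam L₁' := by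
    unfold C2
    gcongr
  have h10 : 0 ≤ C1 d δ c lam L := by unfold C1; positivity
  have h11 : 0 ≤ c₀ * C1 d δ c lam L₁' := mul_nonneg (by linarith) (h10.trans h1)
  have h3 : (s * L₂' / T) ^ (c₀ / 2) ≤ (s * L₂') ^ (c₀ / 2) / T := by
    rw [Real.div_rpow (by positivity) (by positivity)]
    refine div_le_div_of_nonneg_left (by positivity) (by positivity) ?_
    calc (T : ℝ) = (T : ℝ) ^ (1 : ℝ) := (Real.rpow_one _).symm
      _ ≤ _ := Real.rpow_le_rpow_of_exponent_le hT' (by linarith)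
  unfold errorBound
  rw [add_div, add_div]
  have e1 : c₀ * C1 d δ c lam L * (L₁' ^ (c₀ / 2) / T) ≤
      c₀ * C1 d δ c lam L₁' * L₁' ^ (c₀ / 2) / T := by
    rw [mul_div_assoc]
    gcongr
  have e2 : c₀ * C1 d δ c lam L * (s * L₂' / T) ^ (c₀ / 2) ≤
      c₀ * C1 d δ c lam L₁' * (s * L₂') ^ (c₀ / 2) / T := by
    rw [mul_div_assoc (c₀ * C1 d δ c lam L₁')]
    gcongr
  have e3 : C2 c₀ c lam L * s / T ≤ C2 c₀ c lam L₁' * s / T := by gcongr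
  linarith

end Numerics

/-! ### A single-level schedule, its probability, and the conclusion -/

/-- The schedule with the single pair `(0, ε)`. -/
def Schedule.single (ε : ℝ) (hε : 0 < ε) : Schedule where
  J := 0
  time := fun _ => 0
  level := fun _ => ε
  time_zero := rfl
  time_strictMono := Subsingleton.strictMono (α := Fin 1) _
  level_pos := hε
  level_strictMono := Subsingleton.strictMono (α := Fin 1) _

lemma nestedSpace_single {Ω : Type*} {ε : ℝ} (hε : 0 < ε) (Ψ : ℕ → Ω → ℝ) (t : ℕ) :
    nestedSpace (Schedule.single ε hε) Ψ t = stayBelow Ψ ε t := by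
  ext ω
  constructor
  · intro h l hl
    exact h 0 l (Nat.zero_le l) hl
  · intro h _ l _ hl
    exact h l hl

/-- A conditional mean is bounded by a bound on the integral of the odds. -/
lemma integral_cond_le {Ω : Type*} [MeasurableSpace Ω] {P : Measure Ω} [IsProbabilityMeasure P]
    {f : Ω → ℝ} (hf : Measurable f) (hf0 : ∀ ω, 0 ≤ f ω) {A : Set Ω} (hPA : P A ≠ 0) {m : ℝ}
    (hm : 0 ≤ m) (h : ∫⁻ ω in A, odds (f ω) ∂P ≤ ENNReal.ofReal m * P A) :
    ∫ ω, f ω ∂(P[|A]) ≤ m := by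
  rw [integral_eq_lintegral_of_nonneg_ae (Filter.Eventually.of_forall hf0)
    hf.aestronglyMeasurable]
  refine ENNReal.toReal_le_of_le_ofReal hm ?_
  rw [ProbabilityTheory.cond, lintegral_smul_measure, smul_eq_mul]
  calc _ ≤ (P A)⁻¹ * (ENNReal.ofReal m * P A) := by
        gcongr
        exact (lintegral_mono fun ω => ofReal_le_odds (hf0 ω)).trans h
    _ = ENNReal.ofReal m * ((P A)⁻¹ * P A) := by ring
    _ = _ := by rw [ENNReal.inv_mul_cancel hPA (measure_ne_top _ _), mul_one]

/-- Failure means a bad start, or a good start followed by an exit. The exit events increase with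
`t`, so their uniform bound passes to the union. -/
lemma measure_stayBelow_ge {Ω : Type*} [MeasurableSpace Ω] {P : Measure Ω}
    [IsProbabilityMeasure P] {Ψ : ℕ → Ω → ℝ} (hΨ : ∀ t, Measurable (Ψ t)) {ε s δ : ℝ} (hδ : 0 ≤ δ)
    (h0 : P {ω | 1 - s < Ψ 0 ω} ≤ ENNReal.ofReal (δ / 2))
    (h1 : ∀ t, P ({ω | Ψ 0 ω ≤ 1 - s} \ stayBelow Ψ ε (t + 1)) ≤ ENNReal.ofReal (δ / 2)) :
    ENNReal.ofReal (1 - δ) ≤ P (⋂ t : ℕ, ⋂ _ : 0 < t, stayBelow Ψ ε t) := by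
  set I := ⋂ t : ℕ, ⋂ _ : 0 < t, stayBelow Ψ ε t with hI
  have hIm : MeasurableSet I := MeasurableSet.iInter fun t => MeasurableSet.iInter fun _ =>
    measurableSet_stayBelow hΨ ε t
  have h2 : P ({ω | Ψ 0 ω ≤ 1 - s} \ I) ≤ ENNReal.ofReal (δ / 2) := by
    have hU : {ω | Ψ 0 ω ≤ 1 - s} \ I = ⋃ t, {ω | Ψ 0 ω ≤ 1 - s} \ stayBelow Ψ ε (t + 1) := by
      rw [← Set.sdiff_iInter]
      congr 1
      ext ω
      simp only [hI, Set.mem_iInter]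
      constructor
      · exact fun h t => h (t + 1) (Nat.succ_pos t)
      · intro h t ht
        obtain ⟨k, rfl⟩ := Nat.exists_eq_succ_of_ne_zero ht.ne'
        exact h k
    have hmono : Monotone fun t => {ω | Ψ 0 ω ≤ 1 - s} \ stayBelow Ψ ε (t + 1) := fun a b hab =>
      Set.sdiff_subset_sdiff_right (stayBelow_antitone Ψ ε (by omega))
    rw [hU, hmono.measure_iUnion]
    exact iSup_le h1
  have h3 : P Iᶜ ≤ ENNReal.ofReal δ := by
    have : Iᶜ ⊆ {ω | 1 - s < Ψ 0 ω} ∪ ({ω | Ψ 0 ω ≤ 1 - s} \ I) := by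
      intro ω hω
      by_cases h : Ψ 0 ω ≤ 1 - s
      · exact Or.inr ⟨h, hω⟩
      · exact Or.inl (not_le.1 h)
    calc P Iᶜ ≤ _ := measure_mono this
      _ ≤ _ := measure_union_le _ _
      _ ≤ ENNReal.ofReal (δ / 2) + ENNReal.ofReal (δ / 2) := add_le_add h0 h2
      _ = _ := by rw [← ENNReal.ofReal_add (by linarith) (by linarith)]; congr 1; ring
  have h4 : P I = 1 - P Iᶜ := by
    rw [← prob_compl_eq_one_sub hIm.compl, compl_compl]
  rw [h4, ENNReal.ofReal_sub _ hδ, ENNReal.ofReal_one]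
  exact tsub_le_tsub_left h3 1

end DMK

theorem corollary1
    {d : ℕ} (hd : 2 ≤ d)
    -- the data distribution: zero mean, norm bounded by `r ≥ 1`, spectral gap
    (μ : Measure (DMK.Vec d)) [IsProbabilityMeasure μ] (r : ℝ) (hr : 1 ≤ r)
    (hmean : ∫ x, x ∂μ = 0) (hbound : ∀ᵐ x ∂μ, ‖x‖ ≤ r)
    (lam₁ lam₂ : ℝ) (hlam₁ : lam₁ = DMK.eigval μ ⟨0, by omega⟩)
    (hlam₂ : lam₂ = DMK.eigval μ ⟨1, by omega⟩) (hgap : lam₂ < lam₁)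
    -- the unit top eigenvector of the covariance matrix
    (q : DMK.Vec d) (hq : ‖q‖ = 1)
    (hqeig : (DMK.covMatrix μ).mulVec q.ofLp = lam₁ • q.ofLp)
    -- the random initial vector and the i.i.d. data stream
    {Ω : Type*} [MeasurableSpace Ω] (P : Measure Ω) [IsProbabilityMeasure P]
    (v₀ : Ω → DMK.Vec d) (hv₀ : Measurable v₀) (hv₀law : P.map v₀ = DMK.uniformSphere d)
    (x : ℕ → Ω → DMK.Vec d) (hx : ∀ k, Measurable (x k)) (hxlaw : ∀ k, P.map (x k) = μ)
    (hxindep : iIndepFun x P) (hv₀indep : IndepFun v₀ (fun ω k => x k ω) P)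
    -- the parameters
    (c₀ δ : ℝ) (hc₀ : 2 < c₀) (hδ₀ : 0 < δ) (hδ₁ : δ < 1)
    (c : ℝ) (hc : c = DMK.stepConst c₀ lam₁ lam₂)
    (L₁' L₂' : ℝ) (hL₁' : DMK.L1 d r c δ ≤ L₁') :
    ∃ K : ℝ, ∀ N b : ℕ, 1 ≤ N → 1 ≤ b →
      DMK.L2 d (DMK.sigmaBSq μ N b) c δ / DMK.sigmaBSq μ N b ≤ L₂' →
      ∀ L : ℝ, L = L₁' + DMK.sigmaBSq μ N b * L₂' →
      ∀ Ψ : ℕ → Ω → ℝ,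
        (∀ t ω, Ψ t ω = DMK.potential q
          (DMK.iterate N b (fun t => c / (L + t)) (v₀ ω) (fun k => x k ω) t)) →
      ∃ S : DMK.Schedule,
        ENNReal.ofReal (1 - δ) ≤ P (⋂ t : ℕ, ⋂ _ : 0 < t, DMK.nestedSpace S Ψ t) ∧
        ∀ T : ℕ, N * b ∣ T → ((N * b : ℕ) : ℝ) ≤ (T : ℝ) ^ (1 - 2 / c₀) →
          (∫ ω, Ψ (T / (N * b)) ω ∂(P[|DMK.nestedSpace S Ψ (T / (N * b))])) ≤
            DMK.errorBound c₀ (DMK.C1 d δ c lam₁ L) (DMK.C2 c₀ c lam₁ L) L₁' L₂'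
              (DMK.sigmaSq μ) T ∧
          DMK.errorBound c₀ (DMK.C1 d δ c lam₁ L) (DMK.C2 c₀ c lam₁ L) L₁' L₂'
              (DMK.sigmaSq μ) T ≤ K / T := by
  -- `L` depends on the batch through `σ_B ^ 2`. As `C1` and `C2` decrease in `L` and `L₁' ≤ L`,
  -- evaluating them at `L₁'` gives a constant free of `N` and `b`.
  refine ⟨c₀ * DMK.C1 d δ c lam₁ L₁' * L₁' ^ (c₀ / 2) +
    c₀ * DMK.C1 d δ c lam₁ L₁' * (DMK.sigmaSq μ * L₂') ^ (c₀ / 2) +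
    DMK.C2 c₀ c lam₁ L₁' * DMK.sigmaSq μ, ?_⟩
  intro N b hN hb hL₂' L hL Ψ hΨ
  have hgapS := DMK.spectralGap _ _ hbound hlam₁ hlam₂ hgap hq hqeig
  have hlampos := hgapS.lam₁_pos
  have hlamr := hgapS.lam₁_le hbound
  have hlam₂0 := hgapS.lam₂_nonneg
  clear hlam₁ hlam₂
  have hdpos : (0 : ℝ) < d := by
    have : 0 < d := by omega
    exact_mod_cast this
  have hd2 : (2 : ℝ) ≤ d := by exact_mod_cast hd
  have hcpos : 0 < c := by
    rw [hc, DMK.stepConst]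
    exact div_pos (by linarith) (by linarith)
  have hcc₀ : 2 * c * (lam₁ - lam₂) = c₀ := by
    have : lam₁ - lam₂ ≠ 0 := by linarith
    rw [hc, DMK.stepConst]
    field_simp
  set σ := DMK.sigmaBSq μ N b with hσ_def
  have hσ : 0 ≤ σ := DMK.sigmaBSq_nonneg μ N b
  obtain ⟨hL1, hκL, hcL, hγL, hL₁L, hL₁pos, hL₂0⟩ :=
    DMK.offset_bounds hd hr hcpos hδ₀ hδ₁ hσ hlampos.le hlamr hL₁' hL₂' hL
  -- Chosen with `s` below so that `√(s d) = δ / 2` and `2 ε / s = δ / 2`.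
  set ε := δ ^ 3 / (16 * d) with hε_def
  set s := δ ^ 2 / (4 * d) with hs_def
  set κ := 16 * c ^ 2 * (lam₁ ^ 2 + σ / ε) with hκ_def
  have hLpos : 0 < L := by linarith
  have hε : 0 < ε := by positivity
  have hδ3 : δ ^ 3 ≤ 1 := pow_le_one₀ hδ₀.le hδ₁.le
  have hδ2 : δ ^ 2 ≤ 1 := pow_le_one₀ hδ₀.le hδ₁.le
  have hε1 : ε ≤ 1 := by rw [hε_def, div_le_one (by positivity)]; linarith
  have hs : 0 < s := by positivity
  have hs1 : s ≤ 1 := by rw [hs_def, div_le_one (by positivity)]; linarith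
  have hκ : 0 ≤ κ := by positivity
  have hc₀L : c₀ ≤ L / 8 := by
    rw [← hcc₀]
    have : c * (lam₁ - lam₂) ≤ c * r ^ 2 := by gcongr; linarith
    linarith
  have hΨm : ∀ t, Measurable (Ψ t) := by
    intro t
    rw [funext (hΨ t)]
    exact (DMK.measurable_potential q).comp ((DMK.measurable_iterate _ t).comp
      (hv₀.prodMk (measurable_pi_lambda _ hx)))
  have hΨ0 : ∀ t ω, 0 ≤ Ψ t ω := fun t ω => by rw [hΨ]; exact DMK.potential_nonneg hq _
  have hΨ1 : ∀ t ω, Ψ t ω ≤ 1 := fun t ω => by rw [hΨ]; exact DMK.potential_le_one q _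
  -- the one-step recursion
  have hn : ∀ t : ℕ, L ≤ L + ((t + 1 : ℕ) : ℝ) := fun t =>
    le_add_of_nonneg_right (Nat.cast_nonneg _)
  have hγ0 : ∀ t : ℕ, 0 ≤ c / (L + ((t + 1 : ℕ) : ℝ)) := fun t =>
    div_nonneg hcpos.le (hLpos.le.trans (hn t))
  have hγε : ∀ t : ℕ, c / (L + ((t + 1 : ℕ) : ℝ)) * r ^ 2 ≤ √ε / 4 := fun t => by
    refine le_trans ?_ hγL
    rw [div_mul_eq_mul_div]
    exact div_le_div_of_nonneg_left (by positivity) hLpos (hn t)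
  have hαeq : ∀ t : ℕ, 1 - 2 * (c / (L + ((t + 1 : ℕ) : ℝ))) * (lam₁ - lam₂) +
      16 * (c / (L + ((t + 1 : ℕ) : ℝ))) ^ 2 * (lam₁ ^ 2 + σ / ε) =
      1 - c₀ / (L + ((t + 1 : ℕ) : ℝ)) + κ / (L + ((t + 1 : ℕ) : ℝ)) ^ 2 := fun t => by
    rw [← hcc₀, hκ_def, div_pow]
    ring
  have hβeq : ∀ t : ℕ, 4 * (c / (L + ((t + 1 : ℕ) : ℝ))) ^ 2 * σ =
      4 * c ^ 2 * σ / (L + ((t + 1 : ℕ) : ℝ)) ^ 2 := fun t => by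
    rw [div_pow]
    ring
  have hα0 : ∀ t : ℕ,
      0 ≤ 1 - c₀ / (L + ((t + 1 : ℕ) : ℝ)) + κ / (L + ((t + 1 : ℕ) : ℝ)) ^ 2 := fun t => by
    have h1 : c₀ / (L + ((t + 1 : ℕ) : ℝ)) ≤ 1 := by
      have := hn t
      rw [div_le_one (by linarith)]
      linarith
    have h2 : 0 ≤ κ / (L + ((t + 1 : ℕ) : ℝ)) ^ 2 := by positivity
    linarith
  have hβ0 : ∀ t : ℕ, 0 ≤ 4 * c ^ 2 * σ / (L + ((t + 1 : ℕ) : ℝ)) ^ 2 := fun t => by positivity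
  have hstep : ∀ (s : ℝ) (t : ℕ),
      ∫⁻ ω in {ω | Ψ 0 ω ≤ 1 - s} ∩ DMK.stayBelow Ψ ε (t + 1), DMK.odds (Ψ (t + 1) ω) ∂P ≤
      ENNReal.ofReal (1 - c₀ / (L + ((t + 1 : ℕ) : ℝ)) + κ / (L + ((t + 1 : ℕ) : ℝ)) ^ 2) *
        ∫⁻ ω in {ω | Ψ 0 ω ≤ 1 - s} ∩ DMK.stayBelow Ψ ε (t + 1), DMK.odds (Ψ t ω) ∂P +
      ENNReal.ofReal (4 * c ^ 2 * σ / (L + ((t + 1 : ℕ) : ℝ)) ^ 2) *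
        P ({ω | Ψ 0 ω ≤ 1 - s} ∩ DMK.stayBelow Ψ ε (t + 1)) := fun s t => by
    have := hgapS.setLIntegral_odds_le hbound hN hb hv₀ hx hxlaw hxindep hv₀indep hΨ hε hε1
      (t := t) (hγ0 t) (hγε t) ((hαeq t).symm ▸ hα0 t) (s := s)
    rwa [hαeq, hβeq] at this
  -- the probability of the nested sample spaces
  have hprob : ENNReal.ofReal (1 - δ) ≤ P (⋂ t : ℕ, ⋂ _ : 0 < t, DMK.stayBelow Ψ ε t) := by
    refine DMK.measure_stayBelow_ge hΨm hδ₀.le (s := s) ?_ fun t => ?_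
    · have h1 := DMK.uniformSphere_potential_gt_le hd hq hs.le
      have h2 : √(s * d) = δ / 2 := by
        have : s * d = (δ / 2) ^ 2 := by rw [hs_def]; field_simp; norm_num
        rw [this, Real.sqrt_sq (by positivity)]
      rw [h2, ← hv₀law, Measure.map_apply hv₀ (measurableSet_lt measurable_const
        (DMK.measurable_potential q))] at h1
      refine le_trans (le_of_eq ?_) h1
      congr 1
      ext ω
      simp only [Set.mem_ofPred_eq, Set.mem_preimage, hΨ 0 ω]
      rfl
    · refine (DMK.measure_sdiff_stayBelow_le hΨm hε hε1 hs hs1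
        (κ := fun t => 1 + κ / (L + (t : ℝ)) ^ 2) (DMK.growth_zero L κ) (fun t => ?_)
        (DMK.one_add_mul_growth_le hL1 hκ) (fun t => ?_) t).trans ?_
      · have : 0 ≤ κ / (L + ((t + 1 : ℕ) : ℝ)) ^ 2 := by positivity
        linarith
      -- For `1 + odds` the drift is discarded, and the additive noise is charged to the constant
      -- `1`; the same factor `1 + κ / n ^ 2` covers both.
      · set A := {ω | Ψ 0 ω ≤ 1 - s} ∩ DMK.stayBelow Ψ ε (t + 1)
        rw [lintegral_add_left measurable_const, lintegral_add_left measurable_const,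
          setLIntegral_const, one_mul]
        have hk1 : (1 : ℝ) + 4 * c ^ 2 * σ / (L + ((t + 1 : ℕ) : ℝ)) ^ 2 ≤
            1 + κ / (L + ((t + 1 : ℕ) : ℝ)) ^ 2 := by
          gcongr
          have h3 : σ ≤ σ / ε := by rw [le_div_iff₀ hε]; nlinarith
          have h4 : 4 * c ^ 2 * σ ≤ 4 * c ^ 2 * (σ / ε) := by gcongr
          have h5 : 0 ≤ c ^ 2 * (σ / ε) := by positivity
          have h6 : 0 ≤ c ^ 2 * lam₁ ^ 2 := by positivity
          rw [hκ_def]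
          linarith
        have hk2 : 1 - c₀ / (L + ((t + 1 : ℕ) : ℝ)) + κ / (L + ((t + 1 : ℕ) : ℝ)) ^ 2 ≤
            1 + κ / (L + ((t + 1 : ℕ) : ℝ)) ^ 2 := by
          have : 0 ≤ c₀ / (L + ((t + 1 : ℕ) : ℝ)) := by positivity
          linarith
        calc _ ≤ P A + (_ + _) := by gcongr; exact hstep s t
          _ = ENNReal.ofReal (1 + 4 * c ^ 2 * σ / (L + ((t + 1 : ℕ) : ℝ)) ^ 2) * P A +
              ENNReal.ofReal (1 - c₀ / (L + ((t + 1 : ℕ) : ℝ)) + κ / (L + ((t + 1 : ℕ) : ℝ)) ^ 2) *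
              ∫⁻ ω in A, DMK.odds (Ψ t ω) ∂P := by
            rw [ENNReal.ofReal_add zero_le_one (hβ0 t), ENNReal.ofReal_one]
            ring
          _ ≤ ENNReal.ofReal (1 + κ / (L + ((t + 1 : ℕ) : ℝ)) ^ 2) * P A +
              ENNReal.ofReal (1 + κ / (L + ((t + 1 : ℕ) : ℝ)) ^ 2) *
              ∫⁻ ω in A, DMK.odds (Ψ t ω) ∂P := by gcongr
          _ = _ := by ring
      · refine ENNReal.ofReal_le_ofReal ?_
        have h1 := DMK.growth_le hLpos hκ t
        have h2 : Real.exp (κ / L) ≤ 2 := by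
          have h3 : κ / L ≤ Real.log 2 := by
            rw [div_le_iff₀ hLpos]
            nlinarith [Real.log_two_gt_d9]
          calc _ ≤ Real.exp (Real.log 2) := Real.exp_le_exp.2 h3
            _ = 2 := Real.exp_log (by norm_num)
        calc ε * DMK.growth L κ t / s ≤ ε * 2 / s := by gcongr; exact h1.trans h2
          _ = δ / 2 := by rw [hε_def, hs_def]; field_simp; norm_num
  -- the conditional means
  set H := 2 * (4 * c ^ 2 * σ) / (c₀ - 2) with hH
  have hH0 : 0 ≤ H := div_nonneg (by positivity) (by linarith)
  let m : ℕ → ℝ := fun t => 1 / ε * DMK.decay L κ c₀ t + H / (L + t)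
  have hm0 : ∀ t, 0 ≤ m t := fun t => by
    have := DMK.decay_nonneg (κ := κ) (c₀ := c₀) hL1 t
    positivity
  have hmean_le : ∀ t, ∫⁻ ω in DMK.stayBelow Ψ ε (t + 1), DMK.odds (Ψ (t + 1) ω) ∂P ≤
      ENNReal.ofReal (m (t + 1)) * P (DMK.stayBelow Ψ ε (t + 1)) := by
    refine DMK.setLIntegral_odds_le hΨm hε
      (α := fun t => 1 - c₀ / (L + (t : ℝ)) + κ / (L + (t : ℝ)) ^ 2)
      (β := fun t => 4 * c ^ 2 * σ / (L + (t : ℝ)) ^ 2) ?_ hα0 hβ0 hm0 (fun t => ?_) fun t => ?_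
    · simp only [m, DMK.decay_zero hL1, mul_one]
      exact le_add_of_nonneg_right (by positivity)
    · have h1 := DMK.mul_decay_le hL1 hκ (by linarith : 0 ≤ c₀) t
      have h2 := DMK.mul_harmonic_le hL1 (by linarith : κ ≤ L) hc₀
        (by positivity : 0 ≤ 4 * c ^ 2 * σ) hH t
      have h3 := mul_le_mul_of_nonneg_left h1 (by positivity : 0 ≤ 1 / ε)
      simp only [m]
      linarith
    -- The value `s = 0` removes the restriction on the start, since `Ψ ≤ 1` always.
    · have h1 : {ω | Ψ 0 ω ≤ 1 - 0} ∩ DMK.stayBelow Ψ ε (t + 1) = DMK.stayBelow Ψ ε (t + 1) := by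
        refine Set.inter_eq_right.2 fun ω _ => ?_
        simpa using hΨ1 0 ω
      have h2 := hstep 0 t
      rwa [h1] at h2
  refine ⟨DMK.Schedule.single ε hε, ?_, ?_⟩
  · simpa only [DMK.nestedSpace_single] using hprob
  intro T hdvd hBT
  have hB1 : 1 ≤ N * b := Nat.mul_pos hN hb
  have hB1' : (1 : ℝ) ≤ ((N * b : ℕ) : ℝ) := by exact_mod_cast hB1
  -- `T = 0` is a multiple of `B`, but then the right side of the batch condition is `0`, as its
  -- exponent is positive.
  have hT1 : 1 ≤ T := by
    rcases Nat.eq_zero_or_pos T with rfl | h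
    · exfalso
      have : 2 / c₀ < 1 := by rw [div_lt_one (by linarith)]; exact hc₀
      rw [Nat.cast_zero, Real.zero_rpow (by linarith)] at hBT
      linarith
    · exact h
  refine ⟨?_, DMK.errorBound_le hδ₀ hc₀ hL₁pos hL₂0 hL₁L (DMK.sigmaSq_nonneg μ) hT1⟩
  have hTeq : T = T / (N * b) * (N * b) := (Nat.div_mul_cancel hdvd).symm
  have hτ : 1 ≤ T / (N * b) := (Nat.one_le_div_iff hB1).2 (Nat.le_of_dvd hT1 hdvd)
  set τ := T / (N * b)
  refine le_trans ?_ (DMK.bound_le_errorBound hd hδ₀ hδ₁ hσ hL₁pos hL₂0 hL hL1 hκ hκL hc₀ hc₀L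
    hτ hB1 hTeq (DMK.sigmaBSq_mul hN hb hbound) hBT)
  rw [DMK.nestedSpace_single]
  obtain ⟨t, ht⟩ : ∃ t, τ = t + 1 := ⟨τ - 1, by omega⟩
  have hPpos : P (DMK.stayBelow Ψ ε (t + 1)) ≠ 0 := by
    have h1 : P (⋂ t : ℕ, ⋂ _ : 0 < t, DMK.stayBelow Ψ ε t) ≤ P (DMK.stayBelow Ψ ε (t + 1)) :=
      measure_mono (Set.iInter₂_subset _ (Nat.succ_pos t))
    have h2 : 0 < ENNReal.ofReal (1 - δ) := ENNReal.ofReal_pos.2 (by linarith)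
    exact (h2.trans_le (hprob.trans h1)).ne'
  rw [ht]
  exact DMK.integral_cond_le (hΨm _) (hΨ0 _) hPpos (hm0 (t + 1)) (hmean_le t)
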